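/- Let $\Omega\subset\mathbb C=\mathbb R^2$ be a bounded domain with $C^3$ boundary, let $d(z)=\operatorname{dist}(z,\partial\Omega)$, for $\varepsilon>0$ let $\Omega_\varepsilon=\{z\in\Omega: d(z)<\varepsilon\}$, and let $\bar z=2p(z)-z$ be the reflection of $z$ at $\partial\Omega$, where $p(z)\in\partial\Omega$ is the point of $\partial\Omega$ nearest to $z$ (which is unique for $z$ close to $\partial\Omega$). Let $G$ be a real function on $\{(x,y)\in\Omega^2:x\ne y\}$ that is bounded below, such that $G(x,y)=g(x,y)-\frac1{2\pi}\ln|x-y|$ with $g\in C^1(\Omega\times\Omega)$ bounded above, and such that: (a) for every $\varepsilon>0$ there is $C_2>0$ with $|G(x,y)|+|\nabla_xG(x,y)|+|\nabla_yG(x,y)|\le C_2$ for all $x,y\in\Omega$ with $|x-y|\ge\varepsilon$; (b) for some $\varepsilon>0$ and $C_3>0$, the function $\psi(x,y)=g(x,y)-\frac1{2\pi}\ln|\bar x-y|$ satisfies $|\psi|+|\nabla_x\psi|+|\nabla_y\psi|\le C_3$ on $\Omega_\varepsilon\times\Omega_\varepsilon$; (c) there is $C_4>0$ with $G(w+rv,w+sv)-G(w+rv,w+tv)\ge-C_4$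 for all $w\in\mathbb C$, $v\in\mathbb C\setminus\{0\}$ and reals $r<s<t$ for which $w+rv,\,w+sv,\,w+tv\in\Omega$. Let $\mathcal F_N\Omega=\{z\in\Omega^N: z_i\ne z_j\text{ for }i\ne j\}$, let $\Gamma\in\mathbb R^N$ have nonzero entries, and let $$H_\Omega(z)=\sum_{j=1}^N\Gamma_j^2\,g(z_j,z_j)+\sum_{i\ne j}\Gamma_i\Gamma_j\,G(z_i,z_j),\qquad z\in\mathcal F_N\Omega .$$ Suppose that $\Gamma$ is $\Delta$-admissible: $\sum_{i,j\in C,\,i\ne j}\Gamma_i\Gamma_j\ne0$ for every $C\subset\{1,\dots,N\}$ with $|C|\ge2$; and $\partial$-admissible: $\sum_{i\in C}\Gamma_i^2>\sum_{i,j\in C,\,i\ne j}|\Gamma_i\Gamma_j|$ for every such $C$, where, if $\Omega$ is strictly convex (that is, $\overline\Omega$ is a strictly convex set), it is enough that $\sum_{i\in C}\Gamma_i^2>\sum_{i,j\in C,\,\Gamma_i\Gamma_j<0}|\Gamma_i\Gamma_j|$ for every such $C$. (All sums are over ordered pairs $(i,j)$.) Then: 1. There is $\delta>0$ such that $|\nabla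 H_\Omega(z)|>1$ for every $z\in\mathcal F_N\Omega$ such that $|z_i-z_j|\le\delta$ for some $i\ne j$ or $d(z_j)\le\delta$ for some $j$. 2. $H_\Omega$ satisfies the Palais–Smale condition: every sequence $(z^n)$ in $\mathcal F_N\Omega$ such that $H_\Omega(z^n)$ is bounded and $\nabla H_\Omega(z^n)\to0$ has a subsequence that converges to a point of $\mathcal F_N\Omega$. 3. Let $z:[0,t^+)\to\mathcal F_N\Omega$, $0<t^+\le\infty$, be a forward maximal solution of the gradient flow equation $\dot z=\nabla H_\Omega(z)$ such that $\lim_{t\to t^+}H_\Omega(z(t))$ exists and is finite. Then $t^+=\infty$, and there are a sequence $s_n\to\infty$ and a point $z^*\in\mathcal F_N\Omega$ with $z(s_n)\to z^*$ and $\nabla H_\Omega(z^*)=0$. In particular, $H_\Omega$ has a critical point. -/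

import Mathlib

open Filter Topology

namespace PointVortex

/-- The boundary of `Ω ⊆ ℂ = ℝ²` is of class `C³`: near each of its points, `Ω` is the negativity
set of a (real) `C³` function without critical points. -/
def HasC3Boundary (Ω : Set ℂ) : Prop :=
  ∀ x ∈ frontier Ω, ∃ U : Set ℂ, IsOpen U ∧ x ∈ U ∧
    ∃ ρ : ℂ → ℝ, ContDiffOn ℝ 3 ρ U ∧ (∀ y ∈ U, fderiv ℝ ρ y ≠ 0) ∧
      Ω ∩ U = {y | y ∈ U ∧ ρ y < 0}

/-- A bounded planar domain (nonempty, open, connected) with `C³` boundary. -/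
structure IsBoundedC3Domain (Ω : Set ℂ) : Prop where
  isOpen : IsOpen Ω
  isConnected : IsConnected Ω
  isBounded : Bornology.IsBounded Ω
  boundary : HasC3Boundary Ω

/-- `d(z)`, the distance of `z` to the boundary of `Ω`. -/
noncomputable def bdist (Ω : Set ℂ) (z : ℂ) : ℝ := Metric.infDist z (frontier Ω)

/-- The boundary strip `Ω_ε`. -/
def collar (Ω : Set ℂ) (ε : ℝ) : Set ℂ := {z | z ∈ Ω ∧ bdist Ω z < ε}

/-- `p(z)`: a point of the boundary at minimal distance to `z`. For a bounded domain with `C³`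
boundary that point is unique if `z` is close enough to the boundary. -/
noncomputable def proj (Ω : Set ℂ) (z : ℂ) : ℂ :=
  Classical.epsilon fun q => q ∈ frontier Ω ∧ ‖q - z‖ = bdist Ω z

/-- Reflection at the boundary, `2 p(z) - z`. -/
noncomputable def reflect (Ω : Set ℂ) (z : ℂ) : ℂ := 2 * proj Ω z - z

/-- `ψ(x, y) = g(x, y) - (1 / 2π) ln |x̄ - y|`, with `x̄` the reflection of `x`. -/
noncomputable def reflectedPart (Ω : Set ℂ) (g : ℂ → ℂ → ℝ) (x y : ℂ) : ℝ :=
  g x y - 1 / (2 * Real.pi) * Real.log ‖reflect Ω x - y‖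

/-- The standing hypotheses on a (generalized hydrodynamic) Green's function `G` on `Ω`, with
regular part `g`. Only the values `G x y` for distinct `x, y ∈ Ω` and `g x y` for `x, y ∈ Ω`
matter. The norm of the real derivative in one of the variables is the Euclidean norm of the
corresponding partial gradient. -/
structure IsGreenFunction (Ω : Set ℂ) (G g : ℂ → ℂ → ℝ) : Prop where
  /-- `G` is bounded below. -/
  bddBelow : ∃ C₀ : ℝ, ∀ x ∈ Ω, ∀ y ∈ Ω, x ≠ y → C₀ ≤ G x y
  /-- `G` has a logarithmic singularity on the diagonal. -/
  eq_log : ∀ x ∈ Ω, ∀ y ∈ Ω, x ≠ y → G x y = g x y - 1 / (2 * Real.pi) * Real.log ‖x - y‖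
  /-- The regular part is `C¹` on `Ω × Ω`, including the diagonal. -/
  contDiffOn : ContDiffOn ℝ 1 (fun p : ℂ × ℂ => g p.1 p.2) (Ω ×ˢ Ω)
  /-- The regular part is bounded above. -/
  bddAbove : ∃ C₁ : ℝ, 0 < C₁ ∧ ∀ x ∈ Ω, ∀ y ∈ Ω, g x y ≤ C₁
  /-- `C¹`-bounds away from the diagonal. -/
  bound_off_diag : ∀ ε : ℝ, 0 < ε → ∃ C₂ : ℝ, 0 < C₂ ∧ ∀ x ∈ Ω, ∀ y ∈ Ω, ε ≤ ‖x - y‖ →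
    |G x y| + ‖fderiv ℝ (fun x' => G x' y) x‖ + ‖fderiv ℝ (fun y' => G x y') y‖ ≤ C₂
  /-- Near the boundary, `g` is `(1 / 2π) ln |x̄ - y|` up to a `C¹`-bounded term. -/
  bound_reflect : ∃ ε : ℝ, 0 < ε ∧ ∃ C₃ : ℝ, 0 < C₃ ∧ ∀ x ∈ collar Ω ε, ∀ y ∈ collar Ω ε,
    |reflectedPart Ω g x y| + ‖fderiv ℝ (fun x' => reflectedPart Ω g x' y) x‖
      + ‖fderiv ℝ (fun y' => reflectedPart Ω g x y') y‖ ≤ C₃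
  /-- One-sided bound on lines. -/
  bound_lines : ∃ C₄ : ℝ, 0 < C₄ ∧ ∀ w v : ℂ, v ≠ 0 → ∀ r s t : ℝ, r < s → s < t →
    w + (r : ℂ) * v ∈ Ω → w + (s : ℂ) * v ∈ Ω → w + (t : ℂ) * v ∈ Ω →
      -C₄ ≤ G (w + (r : ℂ) * v) (w + (s : ℂ) * v) - G (w + (r : ℂ) * v) (w + (t : ℂ) * v)

/-- `ℂ^N = ℝ^{2N}` with its Euclidean norm. -/
abbrev Conf (N : ℕ) : Type := EuclideanSpace ℂ (Fin N)

/-- The configuration space `F_N Ω` of `N` distinct points of `Ω`. -/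
def configSpace (Ω : Set ℂ) (N : ℕ) : Set (Conf N) :=
  {z | (∀ i, z i ∈ Ω) ∧ ∀ i j, i ≠ j → z i ≠ z j}

/-- The configurations with two points at distance at most `δ`, or with a point at distance at
most `δ` to the boundary. -/
def nearSingular (Ω : Set ℂ) (N : ℕ) (δ : ℝ) : Set (Conf N) :=
  {z | z ∈ configSpace Ω N ∧ ((∃ i j, i ≠ j ∧ ‖z i - z j‖ ≤ δ) ∨ ∃ j, bdist Ω (z j) ≤ δ)}

/-- The Kirchhoff-Routh path function; `g x x` is the Robin function. -/
noncomputable def kirchhoffRouth (G g : ℂ → ℂ → ℝ) {N : ℕ} (Γ : Fin N → ℝ) (z : Conf N) : ℝ :=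
  ∑ j, Γ j ^ 2 * g (z j) (z j) +
    ∑ i, ∑ j ∈ Finset.univ.filter (fun j => j ≠ i), Γ i * Γ j * G (z i) (z j)

/-- `Δ`-admissible vorticities. -/
def DiagAdmissible {N : ℕ} (Γ : Fin N → ℝ) : Prop :=
  ∀ C : Finset (Fin N), 2 ≤ C.card → ∑ i ∈ C, ∑ j ∈ C.filter (fun j => j ≠ i), Γ i * Γ j ≠ 0

/-- `∂`-admissible vorticities. A strictly convex domain is one whose closure is a strictly convex
set (its boundary contains no segment); for such a domain the weaker condition, where
only pairs with vorticities of opposite sign count, is enough. -/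
def BdryAdmissible (Ω : Set ℂ) {N : ℕ} (Γ : Fin N → ℝ) : Prop :=
  (∀ C : Finset (Fin N), 2 ≤ C.card →
    ∑ i ∈ C, ∑ j ∈ C.filter (fun j => j ≠ i), |Γ i * Γ j| < ∑ i ∈ C, Γ i ^ 2) ∨
  (StrictConvex ℝ (closure Ω) ∧ ∀ C : Finset (Fin N), 2 ≤ C.card →
    ∑ i ∈ C, ∑ j ∈ C.filter (fun j => Γ i * Γ j < 0), |Γ i * Γ j| < ∑ i ∈ C, Γ i ^ 2)

/-- The Palais-Smale condition for `H` on the set `F`: a sequence in `F` along which `H` is bounded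
and its gradient tends to `0` has a subsequence that converges to a point of `F`. -/
def PalaisSmale {N : ℕ} (F : Set (Conf N)) (H : Conf N → ℝ) : Prop :=
  ∀ u : ℕ → Conf N, (∀ n, u n ∈ F) → (∃ c : ℝ, ∀ n, |H (u n)| ≤ c) →
    Tendsto (fun n => gradient H (u n)) atTop (𝓝 0) →
      ∃ z ∈ F, ∃ k : ℕ → ℕ, StrictMono k ∧ Tendsto (fun n => u (k n)) atTop (𝓝 z)

/-- On `[0, T)`, with `0 < T ≤ ∞`, the curve `z` stays in `F` and solves `z' = ∇H(z)` (with the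
one-sided derivative at `0`). The values of `z` outside `[0, T)` do not matter. -/
def IsFlowLine {N : ℕ} (F : Set (Conf N)) (H : Conf N → ℝ) (z : ℝ → Conf N) (T : EReal) : Prop :=
  0 < T ∧ ∀ t : ℝ, 0 ≤ t → (t : EReal) < T →
    z t ∈ F ∧ HasDerivWithinAt z (gradient H (z t)) (Set.Ici 0) t

/-- A forward maximal gradient flow line, that is `t ↦ φ(z(0), t)` on `[0, t⁺)` with `T = t⁺`: it
has no extension to a flow line on a longer interval. -/
def IsMaximalFlowLine {N : ℕ} (F : Set (Conf N)) (H : Conf N → ℝ) (z : ℝ → Conf N)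
    (T : EReal) : Prop :=
  IsFlowLine F H z T ∧ ∀ (y : ℝ → Conf N) (T' : EReal), IsFlowLine F H y T' →
    (∀ t : ℝ, 0 ≤ t → (t : EReal) < T → y t = z t) → T' ≤ T

/-- The filter `t → T` from below, for `T ≤ ∞`. -/
noncomputable def toEnd (T : EReal) : Filter ℝ := comap (fun t : ℝ => (t : EReal)) (𝓝[<] T)

end PointVortex

/-!
# Blow-up of the gradient of the Kirchhoff-Routh function, and compactness

Everything rests on one estimate: if `a` is a singular configuration (a point of the closure of the
configuration space `F` outside `F`), then `‖∇H z‖ ≥ c / ‖z - a‖` for `z ∈ F` near `a`, with some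
`c > 0` (`exists_le_norm_gradient_mul`). To prove it, assume that `‖∇H z‖ ‖z - a‖ → 0` along an
ultrafilter on `F` converging to `a`, and find displacements `v z = O(‖z - a‖)` along which the
derivative of `H` has a nonzero limit.

* If points collide at an interior point `x₀`, let `v` be the dilation about `x₀` of the colliding
  points. Only the logarithmic singularities contribute in the limit, which is `-(1 / 2π) ∑ Γ i Γ j`
  over the ordered pairs in the cluster; it is nonzero by `Δ`-admissibility
  (`not_tendsto_of_interior_collision`).
* If points converge to a boundary point, let `z m` be the one nearest to the boundary, at distance
  `d`, and let `v` be the dilation about the projection `p` of `z m` of the points whose distance to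
  `z m` is `O(d)`. Reflection at the boundary is `C¹` up to the boundary and fixes `p`, so it
  commutes with this dilation up to `o(d)`. As `g x y` is `(1 / 2π) ln |x̄ - y|` up to a `C¹`-bounded
  term, each `g (z i) (z j)` of the cluster changes at a rate that tends to `1 / 2π`, which cancels
  in `G (z i) (z j)` against the rate of the logarithm. The remaining points are at distance `≫ d`,
  and their interactions with the cluster contribute nothing in the limit. What is left is
  `(1 / 2π) ∑ (Γ i) ^ 2 > 0` over the cluster (`not_tendsto_of_boundary_limit`).

The smoothness of the reflection (`contDiffAt_reflect`) comes from the inverse function theorem and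
Lagrange multipliers.

As `Ω` is bounded, configurations subconverge, and the estimate gives the lower bound for the
gradient near the singular set as well as the Palais-Smale condition. For a flow line on `[0, r)`
with `r` finite and `H` convergent, the length is finite, so the line has a limit `a`. If `a ∉ F`,
the estimate makes `H + c log ‖z - a‖` nondecreasing, although it tends to `-∞`
(`IsFlowLine.limit_mem`). If `a ∈ F`, the line can be extended (`IsMaximalFlowLine.limit_notMem`);
since `∇H` is only continuous, the extension uses Peano's existence theorem
(`exists_local_solution`). So the line is global, `‖∇H‖` becomes small at late times because `H`
stays bounded, and the Palais-Smale condition yields the critical point.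
-/

namespace PointVortex

open InnerProductSpace

/-! ### The nearest-point projection and the reflection near the boundary -/

theorem proj_spec {Ω : Set ℂ} (hne : (frontier Ω).Nonempty) (z : ℂ) :
    proj Ω z ∈ frontier Ω ∧ ‖proj Ω z - z‖ = bdist Ω z := by
  refine Classical.epsilon_spec (p := fun q => q ∈ frontier Ω ∧ ‖q - z‖ = bdist Ω z) ?_
  obtain ⟨q, hq, h⟩ := isClosed_frontier.exists_infDist_eq_dist hne z
  exact ⟨q, hq, by rw [bdist, h, dist_comm, dist_eq_norm]⟩

theorem bdist_le {Ω : Set ℂ} {q : ℂ} (hq : q ∈ frontier Ω) (z : ℂ) : bdist Ω z ≤ ‖z - q‖ := by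
  rw [← dist_eq_norm]; exact Metric.infDist_le_dist_of_mem hq

theorem bdist_nonneg (Ω : Set ℂ) (z : ℂ) : 0 ≤ bdist Ω z := Metric.infDist_nonneg

theorem bdist_pos {Ω : Set ℂ} (hΩ : IsOpen Ω) (hne : (frontier Ω).Nonempty) {z : ℂ} (hz : z ∈ Ω) :
    0 < bdist Ω z := by
  refine (isClosed_frontier.notMem_iff_infDist_pos hne).1 fun h => ?_
  rw [hΩ.frontier_eq] at h
  exact h.2 hz

theorem norm_reflect_sub {Ω : Set ℂ} (hne : (frontier Ω).Nonempty) (z : ℂ) :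
    ‖reflect Ω z - z‖ = 2 * bdist Ω z := by
  rw [← (proj_spec hne z).2, reflect, show 2 * proj Ω z - z - z = 2 * (proj Ω z - z) by ring]
  simp

theorem proj_of_mem_frontier {Ω : Set ℂ} {q : ℂ} (hq : q ∈ frontier Ω) : proj Ω q = q := by
  have h := (proj_spec ⟨q, hq⟩ q).2
  rw [bdist, Metric.infDist_zero_of_mem hq] at h
  exact sub_eq_zero.1 (norm_eq_zero.1 h)

theorem reflect_of_mem_frontier {Ω : Set ℂ} {q : ℂ} (hq : q ∈ frontier Ω) : reflect Ω q = q := by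
  rw [reflect, proj_of_mem_frontier hq]; ring

theorem tendsto_proj {Ω : Set ℂ} {x₀ : ℂ} (h₀ : x₀ ∈ frontier Ω) :
    Tendsto (proj Ω) (𝓝 x₀) (𝓝 x₀) := by
  have h : ∀ z, ‖proj Ω z - x₀‖ ≤ 2 * ‖z - x₀‖ := fun z => by
    have h1 := (proj_spec ⟨x₀, h₀⟩ z).2
    have h2 := bdist_le h₀ z
    have h3 := norm_add_le (proj Ω z - z) (z - x₀)
    rw [sub_add_sub_cancel] at h3
    linarith
  rw [tendsto_iff_norm_sub_tendsto_zero]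
  refine squeeze_zero (fun _ => norm_nonneg _) h ?_
  have : Tendsto (fun z : ℂ => 2 * ‖z - x₀‖) (𝓝 x₀) (𝓝 (2 * ‖x₀ - x₀‖)) := by
    apply Continuous.tendsto; fun_prop
  simpa using this

/-- A local defining function of a `C³` domain also cuts out its boundary. -/
theorem exists_defining_function {Ω : Set ℂ} (hΩ : IsOpen Ω) (hC : HasC3Boundary Ω) {x₀ : ℂ}
    (h₀ : x₀ ∈ frontier Ω) : ∃ ρ : ℂ → ℝ, ContDiffAt ℝ 3 ρ x₀ ∧ fderiv ℝ ρ x₀ ≠ 0 ∧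
      (∀ᶠ y in 𝓝 x₀, y ∈ Ω ↔ ρ y < 0) ∧ ∀ᶠ y in 𝓝 x₀, y ∈ frontier Ω ↔ ρ y = 0 := by
  obtain ⟨U, hU, hxU, ρ, hρ, hd, hUρ⟩ := hC x₀ h₀
  have hin : ∀ y ∈ U, (y ∈ Ω ↔ ρ y < 0) := fun y hy => by
    have := Set.ext_iff.1 hUρ y
    simpa [hy] using this
  have hda : ∀ y ∈ U, DifferentiableAt ℝ ρ y := fun y hy =>
    (hρ.contDiffAt (hU.mem_nhds hy)).differentiableAt (by norm_num)
  refine ⟨ρ, hρ.contDiffAt (hU.mem_nhds hxU), hd x₀ hxU,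
    (eventually_mem_set.2 (hU.mem_nhds hxU)).mono hin,
    (eventually_mem_set.2 (hU.mem_nhds hxU)).mono fun y hy => ?_⟩
  rw [hΩ.frontier_eq]
  constructor
  · rintro ⟨hcl, hn⟩
    refine le_antisymm ?_ (not_lt.1 fun h => hn ((hin y hy).2 h))
    by_contra! hpos
    have hev := ((hda y hy).continuousAt.eventually (lt_mem_nhds hpos)).and (hU.mem_nhds hy)
    obtain ⟨w, ⟨hw, hwU⟩, hwΩ⟩ := mem_closure_iff_nhds.1 hcl _ hev
    exact (lt_asymm hw) ((hin w hwU).1 hwΩ)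
  · intro h0
    refine ⟨?_, fun h => by have := (hin y hy).1 h; linarith⟩
    by_contra hncl
    -- otherwise `ρ` would have a local minimum, hence a critical point, at `y`
    refine hd y hy (IsLocalMin.fderiv_eq_zero ?_)
    filter_upwards [isClosed_closure.isOpen_compl.mem_nhds hncl, hU.mem_nhds hy] with w hw hwU
    rw [h0]
    exact not_lt.1 fun h => hw (subset_closure ((hin w hwU).2 h))

/-- Lagrange multipliers: near a boundary point, `z - proj Ω z` is normal to the boundary. -/
theorem eventually_sub_proj_eq_smul {Ω : Set ℂ} {x₀ : ℂ} (h₀ : x₀ ∈ frontier Ω) {ρ : ℂ → ℝ}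
    (hρ : ContDiffAt ℝ 3 ρ x₀) (hd : fderiv ℝ ρ x₀ ≠ 0)
    (hfr : ∀ᶠ y in 𝓝 x₀, y ∈ frontier Ω ↔ ρ y = 0) :
    ∀ᶠ z in 𝓝 x₀, gradient ρ (proj Ω z) ≠ 0 ∧
      ∃ a : ℝ, z - proj Ω z = a • gradient ρ (proj Ω z) := by
  have hdne : ∀ᶠ q in 𝓝 x₀, fderiv ℝ ρ q ≠ 0 :=
    ((hρ.fderiv_right (m := 2) (by norm_num)).continuousAt).eventually_ne hd
  have hcd : ∀ᶠ q in 𝓝 x₀, ContDiffAt ℝ 3 ρ q := hρ.eventually (by simp)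
  filter_upwards [(tendsto_proj h₀).eventually hdne, (tendsto_proj h₀).eventually hcd,
    (tendsto_proj h₀).eventually hfr.eventually_nhds] with z hz1 hz2 hz3
  obtain ⟨hq, hqz⟩ := proj_spec ⟨x₀, h₀⟩ z
  have hg : gradient ρ (proj Ω z) ≠ 0 := by
    intro h
    apply hz1
    rw [← toDual_gradient, h, map_zero]
  refine ⟨hg, ?_⟩
  set q := proj Ω z
  have hq0 : ρ q = 0 := hz3.self_of_nhds.1 hq
  have hext : IsLocalExtrOn (fun y : ℂ => ‖y - z‖ ^ 2) {y | ρ y = ρ q} q := by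
    left
    have : ∀ᶠ y in 𝓝[{y | ρ y = ρ q}] q, (y ∈ frontier Ω ↔ ρ y = 0) ∧ ρ y = ρ q :=
      (hz3.filter_mono nhdsWithin_le_nhds).and self_mem_nhdsWithin
    filter_upwards [this] with y hy
    have h1 := bdist_le (hy.1.2 (hy.2.trans hq0)) z
    rw [← hqz, norm_sub_rev z y] at h1
    gcongr
  have h1 : HasStrictFDerivAt ρ (fderiv ℝ ρ q) q := hz2.hasStrictFDerivAt (by norm_num)
  have h2 := (hasStrictFDerivAt_norm_sq (q - z)).comp q
    ((hasStrictFDerivAt_id (𝕜 := ℝ) q).sub_const z)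
  obtain ⟨a, b, hab, h⟩ := hext.exists_multipliers_of_hasStrictFDerivAt_1d h1 h2
  have hv : ∀ v, a * inner ℝ (gradient ρ q) v + b * (2 * inner ℝ (q - z) v) = 0 := fun v => by
    have := DFunLike.congr_fun h v
    simp at this ⊢
    linarith
  have hvec : a • gradient ρ q + (2 * b) • (q - z) = 0 := by
    refine ext_inner_right ℝ fun v => ?_
    rw [inner_add_left, real_inner_smul_left, real_inner_smul_left, inner_zero_left, ← hv v]
    ring
  have hb : b ≠ 0 := by
    rintro rfl
    have : a ≠ 0 := by rintro rfl; exact hab rfl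
    simp [this, hg] at hvec
  refine ⟨a / (2 * b), ?_⟩
  have : (2 * b) • (z - q) = a • gradient ρ q := by
    rw [← sub_eq_zero, ← neg_eq_zero, ← hvec, ← neg_sub q z, smul_neg]; abel
  rw [div_eq_inv_mul, mul_smul, ← this, smul_smul, inv_mul_cancel₀ (by simpa using hb), one_smul]

/-- Near the boundary of a `C³` domain the nearest-point projection is `C¹`: by the inverse function
theorem, `(q, a) ↦ (q + a ∇ρ(q), ρ(q))` has a `C¹` local inverse, and it maps `(z, 0)` to
`(proj Ω z, a)` for some multiplier `a`. This identifies every choice of a nearest point, so that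
uniqueness of the nearest point need not be known beforehand. -/
theorem contDiffAt_proj {Ω : Set ℂ} (hΩ : IsOpen Ω) (hC : HasC3Boundary Ω) {x₀ : ℂ}
    (h₀ : x₀ ∈ frontier Ω) : ContDiffAt ℝ 1 (proj Ω) x₀ := by
  obtain ⟨ρ, hρ, hd, -, hfr⟩ := exists_defining_function hΩ hC h₀
  have hgr : ContDiffAt ℝ 1 (gradient ρ) x₀ :=
    (toDual ℝ ℂ).symm.contDiff.contDiffAt.comp x₀ (hρ.fderiv_right (m := 1) (by norm_num))
  have hρ0 : ρ x₀ = 0 := hfr.self_of_nhds.1 h₀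
  set n := gradient ρ x₀ with hn
  have hn0 : n ≠ 0 := fun h => hd (by rw [← toDual_gradient, ← hn, h, map_zero])
  let Φ : ℂ × ℝ → ℂ × ℝ := fun p => (p.1 + p.2 • gradient ρ p.1, ρ p.1)
  have hΦ : ContDiffAt ℝ 1 Φ (x₀, 0) := by
    have h1 : ContDiffAt ℝ 1 (fun p : ℂ × ℝ => gradient ρ p.1) (x₀, 0) :=
      ContDiffAt.comp (x₀, (0 : ℝ)) (f := Prod.fst) hgr contDiffAt_fst
    have h2 : ContDiffAt ℝ 1 (fun p : ℂ × ℝ => ρ p.1) (x₀, 0) :=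
      ContDiffAt.comp (x₀, (0 : ℝ)) (f := Prod.fst) (hρ.of_le (by norm_num)) contDiffAt_fst
    exact (contDiffAt_fst.add (contDiffAt_snd.smul h1)).prodMk h2
  let T : ℂ × ℝ →L[ℝ] ℂ × ℝ :=
    (ContinuousLinearMap.fst ℝ ℂ ℝ + (ContinuousLinearMap.snd ℝ ℂ ℝ).smulRight n).prod
      ((fderiv ℝ ρ x₀).comp (ContinuousLinearMap.fst ℝ ℂ ℝ))
  have hT : HasFDerivAt Φ T (x₀, 0) := by
    have h1 : HasFDerivAt (fun p : ℂ × ℝ => gradient ρ p.1)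
        ((fderiv ℝ (gradient ρ) x₀).comp (ContinuousLinearMap.fst ℝ ℂ ℝ)) (x₀, 0) :=
      HasFDerivAt.comp (x₀, (0 : ℝ)) (f := Prod.fst)
        (hgr.differentiableAt (by norm_num)).hasFDerivAt hasFDerivAt_fst
    have h2 : HasFDerivAt (fun p : ℂ × ℝ => ρ p.1)
        ((fderiv ℝ ρ x₀).comp (ContinuousLinearMap.fst ℝ ℂ ℝ)) (x₀, 0) :=
      HasFDerivAt.comp (x₀, (0 : ℝ)) (f := Prod.fst)
        (hρ.differentiableAt (by norm_num)).hasFDerivAt hasFDerivAt_fst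
    have h3 : HasFDerivAt (fun p : ℂ × ℝ => p.2) (ContinuousLinearMap.snd ℝ ℂ ℝ) (x₀, (0 : ℝ)) :=
      hasFDerivAt_snd
    have h4 := (hasFDerivAt_fst (𝕜 := ℝ) (p := (x₀, (0 : ℝ)))).add (h3.smul h1)
    refine (h4.prodMk h2).congr_fderiv ?_
    ext v <;> simp [T, hn]
  have hinj : Function.Injective T := by
    refine (injective_iff_map_eq_zero T).2 fun ⟨u, a⟩ h => ?_
    have h1 : u + a • n = 0 := congrArg Prod.fst h
    have h2 : fderiv ℝ ρ x₀ u = 0 := congrArg Prod.snd h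
    rw [← toDual_gradient, toDual_apply_apply, ← hn, eq_neg_of_add_eq_zero_left h1, inner_neg_right,
      real_inner_smul_right, real_inner_self_eq_norm_sq] at h2
    have ha : a = 0 := by
      have := norm_ne_zero_iff.2 hn0
      simpa [this] using h2
    rw [ha, zero_smul, add_zero] at h1
    simp [ha, h1]
  let e : (ℂ × ℝ) ≃L[ℝ] ℂ × ℝ :=
    (LinearEquiv.ofInjectiveEndo (T : ℂ × ℝ →ₗ[ℝ] ℂ × ℝ) hinj).toContinuousLinearEquiv
  have he : (e : ℂ × ℝ →L[ℝ] ℂ × ℝ) = T := by ext v <;> rfl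
  rw [← he] at hT
  have hΦ0 : Φ (x₀, 0) = (x₀, 0) := by simp [Φ, hρ0]
  have hinv := hΦ.to_localInverse hT (by norm_num)
  rw [hΦ0] at hinv
  -- the multiplier, written so that its continuity is apparent
  let a : ℂ → ℝ := fun z =>
    inner ℝ (z - proj Ω z) (gradient ρ (proj Ω z)) / ‖gradient ρ (proj Ω z)‖ ^ 2
  have hproj := tendsto_proj h₀
  have hatend : Tendsto a (𝓝 x₀) (𝓝 0) := by
    have h1 : Tendsto (fun z => gradient ρ (proj Ω z)) (𝓝 x₀) (𝓝 n) :=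
      hgr.continuousAt.tendsto.comp hproj
    have h2 : Tendsto (fun z => z - proj Ω z) (𝓝 x₀) (𝓝 (x₀ - x₀)) := tendsto_id.sub hproj
    have := (h2.inner h1).div (h1.norm.pow 2) (pow_ne_zero 2 (norm_ne_zero_iff.2 hn0))
    rw [sub_self, inner_zero_left, zero_div] at this
    exact this
  have hleft := (hΦ.hasStrictFDerivAt' hT (by norm_num)).eventually_left_inverse
  have hpair : Tendsto (fun z => (proj Ω z, a z)) (𝓝 x₀) (𝓝 (x₀, 0)) := hproj.prodMk_nhds hatend
  have hev : ∀ᶠ z in 𝓝 x₀, (hΦ.localInverse hT (by norm_num) (z, 0)).1 = proj Ω z := by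
    filter_upwards [hpair.eventually hleft, eventually_sub_proj_eq_smul h₀ hρ hd hfr,
      hproj.eventually hfr] with z hz1 ⟨hz2, b, hb⟩ hz3
    have hab : a z = b := by
      have := norm_ne_zero_iff.2 hz2
      simp only [a]
      rw [hb, real_inner_smul_left, real_inner_self_eq_norm_sq]
      field_simp
    have hz : Φ (proj Ω z, a z) = (z, 0) := by
      simp only [Φ, hab, ← hb, hz3.1 (proj_spec ⟨x₀, h₀⟩ z).1, add_sub_cancel]
    rw [hz] at hz1
    exact congrArg Prod.fst hz1
  have hpj : ContDiffAt ℝ 1 (fun z : ℂ => (z, (0 : ℝ))) x₀ := contDiffAt_id.prodMk contDiffAt_const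
  exact (contDiffAt_fst.comp x₀ (ContDiffAt.comp x₀ (f := fun z : ℂ => (z, (0 : ℝ)))
    hinv hpj)).congr_of_eventuallyEq (hev.mono fun _ h => h.symm)

theorem contDiffAt_reflect {Ω : Set ℂ} (hΩ : IsOpen Ω) (hC : HasC3Boundary Ω) {x₀ : ℂ}
    (h₀ : x₀ ∈ frontier Ω) : ContDiffAt ℝ 1 (reflect Ω) x₀ :=
  (contDiffAt_const.mul (contDiffAt_proj hΩ hC h₀)).sub contDiffAt_id

/-- The reflected point stays away from `Ω`, at a distance comparable to that of the point. -/
theorem eventually_bdist_le_norm_reflect_sub {Ω : Set ℂ} (hΩ : IsOpen Ω) (hC : HasC3Boundary Ω)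
    {x₀ : ℂ} (h₀ : x₀ ∈ frontier Ω) :
    ∀ᶠ p : ℂ × ℂ in 𝓝 (x₀, x₀), p.1 ∈ Ω → p.2 ∈ Ω →
      bdist Ω p.1 ≤ 4 * ‖reflect Ω p.1 - p.2‖ := by
  obtain ⟨ρ, hρ, hd, hin, hfr⟩ := exists_defining_function hΩ hC h₀
  have hgr : ContinuousAt (gradient ρ) x₀ :=
    (toDual ℝ ℂ).symm.continuous.continuousAt.comp
      (hρ.fderiv_right (m := 1) (by norm_num)).continuousAt
  set n := gradient ρ x₀ with hn
  have hn0 : 0 < ‖n‖ := norm_pos_iff.2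
    fun h => hd (by rw [← toDual_gradient, ← hn, h, map_zero])
  have hstr : HasStrictFDerivAt ρ (toDual ℝ ℂ n) x₀ := by
    rw [hn, toDual_gradient]; exact hρ.hasStrictFDerivAt (by norm_num)
  have hη : 0 < ‖n‖ / 4 := by positivity
  have hs : ∀ᶠ p : ℂ × ℂ in 𝓝 (x₀, x₀),
      |ρ p.1 - ρ p.2 - inner ℝ n (p.1 - p.2)| ≤ ‖n‖ / 4 * ‖p.1 - p.2‖ := by
    filter_upwards [hstr.isLittleO.def hη] with p hp
    simpa using hp
  have hng : ∀ᶠ z in 𝓝 x₀, ‖gradient ρ (proj Ω z) - n‖ < ‖n‖ / 4 := by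
    have := (hgr.tendsto.comp (tendsto_proj h₀)).eventually (Metric.ball_mem_nhds _ hη)
    simpa [dist_eq_norm] using this
  have hrefl : Tendsto (reflect Ω) (𝓝 x₀) (𝓝 x₀) := by
    have := (contDiffAt_reflect hΩ hC h₀).continuousAt.tendsto
    rwa [reflect_of_mem_frontier h₀] at this
  have hpr := tendsto_proj h₀
  have h1 : Tendsto Prod.fst (𝓝 (x₀, x₀)) (𝓝 x₀) := continuous_fst.tendsto (x₀, x₀)
  have h2 : Tendsto Prod.snd (𝓝 (x₀, x₀)) (𝓝 x₀) := continuous_snd.tendsto (x₀, x₀)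
  filter_upwards [((h1.prodMk_nhds (hpr.comp h1))).eventually hs,
    ((hrefl.comp h1).prodMk_nhds (hpr.comp h1)).eventually hs,
    ((hrefl.comp h1).prodMk_nhds h2).eventually hs, h1.eventually hng,
    h1.eventually (eventually_sub_proj_eq_smul h₀ hρ hd hfr), h1.eventually hin,
    h2.eventually hin, (hpr.comp h1).eventually hfr]
    with ⟨x, y⟩ e1 e2 e3 e4 ⟨e5, a, e6⟩ e7 e8 e9 hx hy
  simp only [Function.comp_apply] at *
  obtain ⟨hq, hqd⟩ := proj_spec ⟨x₀, h₀⟩ x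
  set q := proj Ω x
  set m := gradient ρ q
  have hρx := e7.1 hx
  have hρy := e8.1 hy
  have hρq := e9.1 hq
  have hrq : reflect Ω x - q = -(x - q) := by simp only [reflect, q]; ring
  rw [hρq] at e1 e2
  rw [hrq, inner_neg_right, norm_neg] at e2
  rw [norm_sub_rev] at hqd
  rw [hqd] at e1 e2
  have hdpos := bdist_nonneg Ω x
  rw [e6, norm_smul] at hqd
  rw [e6, real_inner_smul_right] at e1 e2
  have hmn : inner ℝ n m ≥ 3 / 4 * ‖n‖ ^ 2 := by
    have : inner ℝ n m = ‖n‖ ^ 2 + inner ℝ n (m - n) := by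
      rw [inner_sub_right, real_inner_self_eq_norm_sq]; ring
    have h := abs_le.1 (abs_real_inner_le_norm n (m - n))
    nlinarith
  have hm : ‖m‖ ≤ 5 / 4 * ‖n‖ := by
    have := norm_sub_norm_le m n
    linarith
  rw [abs_le] at e1 e2 e3
  have hc := abs_le.1 (abs_real_inner_le_norm n (reflect Ω x - y))
  set d := bdist Ω x
  set s := ‖reflect Ω x - y‖
  have key : ∀ b : ℝ, 0 ≤ b → b * ‖m‖ = d → 3 / 5 * ‖n‖ * d ≤ b * inner ℝ n m := by
    intro b hb hbd
    have h1 : b * (3 / 4 * ‖n‖ ^ 2) ≤ b * inner ℝ n m := mul_le_mul_of_nonneg_left hmn hb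
    have h2 : b * ‖m‖ ≤ b * (5 / 4 * ‖n‖) := mul_le_mul_of_nonneg_left hm hb
    nlinarith
  rw [Real.norm_eq_abs] at hqd
  have ha : a < 0 := by
    by_contra! ha
    rw [abs_of_nonneg ha] at hqd
    have := key a ha hqd
    nlinarith
  rw [abs_of_neg ha] at hqd
  have := key (-a) (by linarith) hqd
  have h3 : 7 / 20 * ‖n‖ * d ≤ 5 / 4 * ‖n‖ * s := by nlinarith
  have h4 : 7 / 20 * d ≤ 5 / 4 * s := by nlinarith
  have : 0 ≤ s := norm_nonneg _
  linarith

/-! ### Derivatives of the Green's function and of its regular part -/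

/-- The joint real derivative of a function of two complex variables. -/
noncomputable def pairDeriv (f : ℂ → ℂ → ℝ) (x y : ℂ) : ℂ × ℂ →L[ℝ] ℝ :=
  fderiv ℝ (fun p : ℂ × ℂ => f p.1 p.2) (x, y)

theorem hasFDerivAt_log_norm {x : ℂ} (hx : x ≠ 0) :
    HasFDerivAt (fun h : ℂ => Real.log ‖h‖) ((‖x‖ ^ 2)⁻¹ • innerSL ℝ x) x := by
  have h0 := norm_pos_iff.2 hx
  have h1 : HasFDerivAt (fun h : ℂ => 1 / 2 * Real.log (‖h‖ ^ 2))
      ((1 / 2 : ℝ) • ((‖x‖ ^ 2)⁻¹ • (2 • innerSL ℝ x))) x :=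
    (((hasStrictFDerivAt_norm_sq x).hasFDerivAt).log (by positivity)).const_mul (1 / 2)
  have h2 : (fun h : ℂ => 1 / 2 * Real.log (‖h‖ ^ 2)) = fun h : ℂ => Real.log ‖h‖ := by
    funext h
    rw [Real.log_pow]
    push_cast
    ring
  rw [h2] at h1
  refine h1.congr_fderiv ?_
  ext v
  simp only [smul_apply, smul_eq_mul, nsmul_eq_mul]
  push_cast
  ring

section PartialDerivatives

variable {f : ℂ → ℂ → ℝ} {x y : ℂ}

theorem hasFDerivAt_fst_variable
    (h : HasFDerivAt (fun p : ℂ × ℂ => f p.1 p.2) (pairDeriv f x y) (x, y)) :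
    HasFDerivAt (fun x' => f x' y) ((pairDeriv f x y).comp (.inl ℝ ℂ ℂ)) x :=
  HasFDerivAt.comp x (f := fun x' : ℂ => (x', y)) h (hasFDerivAt_prodMk_left x y)

theorem hasFDerivAt_snd_variable
    (h : HasFDerivAt (fun p : ℂ × ℂ => f p.1 p.2) (pairDeriv f x y) (x, y)) :
    HasFDerivAt (fun y' => f x y') ((pairDeriv f x y).comp (.inr ℝ ℂ ℂ)) y :=
  HasFDerivAt.comp y (f := fun y' : ℂ => (x, y')) h (hasFDerivAt_prodMk_right x y)

theorem pairDeriv_split (f : ℂ → ℂ → ℝ) (x y u w : ℂ) :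
    pairDeriv f x y (u, w) =
      (pairDeriv f x y).comp (.inl ℝ ℂ ℂ) u + (pairDeriv f x y).comp (.inr ℝ ℂ ℂ) w := by
  simp [← map_add]

end PartialDerivatives

namespace IsGreenFunction

variable {Ω : Set ℂ} {G g : ℂ → ℂ → ℝ}

theorem contDiffAt (hG : IsGreenFunction Ω G g) (hΩ : IsOpen Ω) {x y : ℂ} (hx : x ∈ Ω)
    (hy : y ∈ Ω) : ContDiffAt ℝ 1 (fun p : ℂ × ℂ => g p.1 p.2) (x, y) :=
  hG.contDiffOn.contDiffAt ((hΩ.prod hΩ).mem_nhds ⟨hx, hy⟩)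

theorem hasFDerivAt_regular (hG : IsGreenFunction Ω G g) (hΩ : IsOpen Ω) {x y : ℂ} (hx : x ∈ Ω)
    (hy : y ∈ Ω) : HasFDerivAt (fun p : ℂ × ℂ => g p.1 p.2) (pairDeriv g x y) (x, y) :=
  ((hG.contDiffAt hΩ hx hy).differentiableAt (by norm_num)).hasFDerivAt

theorem eventuallyEq_log (hG : IsGreenFunction Ω G g) (hΩ : IsOpen Ω) {x y : ℂ} (hx : x ∈ Ω)
    (hy : y ∈ Ω) (hxy : x ≠ y) : (fun p : ℂ × ℂ => G p.1 p.2) =ᶠ[𝓝 (x, y)]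
      fun p => g p.1 p.2 - 1 / (2 * Real.pi) * Real.log ‖p.1 - p.2‖ := by
  have h1 : ∀ᶠ p : ℂ × ℂ in 𝓝 (x, y), p.1 ≠ p.2 :=
    (isOpen_ne_fun continuous_fst continuous_snd).mem_nhds hxy
  filter_upwards [(hΩ.prod hΩ).mem_nhds (show (x, y) ∈ Ω ×ˢ Ω from ⟨hx, hy⟩), h1] with p hp hne
  exact hG.eq_log _ hp.1 _ hp.2 hne

theorem contDiffAt_green (hG : IsGreenFunction Ω G g) (hΩ : IsOpen Ω) {x y : ℂ} (hx : x ∈ Ω)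
    (hy : y ∈ Ω) (hxy : x ≠ y) : ContDiffAt ℝ 1 (fun p : ℂ × ℂ => G p.1 p.2) (x, y) := by
  refine ContDiffAt.congr_of_eventuallyEq ?_ (hG.eventuallyEq_log hΩ hx hy hxy)
  have h0 : x - y ≠ 0 := sub_ne_zero.2 hxy
  have h1 : ContDiffAt ℝ 1 (fun p : ℂ × ℂ => Real.log ‖p.1 - p.2‖) (x, y) :=
    ((contDiffAt_fst.sub contDiffAt_snd).norm ℝ h0).log (by simpa using h0)
  exact (hG.contDiffAt hΩ hx hy).sub (contDiffAt_const.mul h1)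

theorem hasFDerivAt_green (hG : IsGreenFunction Ω G g) (hΩ : IsOpen Ω) {x y : ℂ} (hx : x ∈ Ω)
    (hy : y ∈ Ω) (hxy : x ≠ y) :
    HasFDerivAt (fun p : ℂ × ℂ => G p.1 p.2) (pairDeriv G x y) (x, y) :=
  ((hG.contDiffAt_green hΩ hx hy hxy).differentiableAt (by norm_num)).hasFDerivAt

theorem pairDeriv_green (hG : IsGreenFunction Ω G g) (hΩ : IsOpen Ω) {x y : ℂ} (hx : x ∈ Ω)
    (hy : y ∈ Ω) (hxy : x ≠ y) (u w : ℂ) :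
    pairDeriv G x y (u, w) = pairDeriv g x y (u, w)
      - 1 / (2 * Real.pi) * (inner ℝ (x - y) (u - w) / ‖x - y‖ ^ 2) := by
  have h1 : HasFDerivAt (fun p : ℂ × ℂ => Real.log ‖p.1 - p.2‖) _ (x, y) :=
    HasFDerivAt.comp (x, y) (f := fun p : ℂ × ℂ => p.1 - p.2)
      (hasFDerivAt_log_norm (sub_ne_zero.2 hxy)) (hasFDerivAt_fst.sub hasFDerivAt_snd)
  have h2 := ((hG.hasFDerivAt_regular hΩ hx hy).sub (h1.const_mul (1 / (2 * Real.pi))))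
  have h3 := (hG.hasFDerivAt_green hΩ hx hy hxy).unique
    (h2.congr_of_eventuallyEq (hG.eventuallyEq_log hΩ hx hy hxy))
  rw [h3, sub_apply, smul_apply, ContinuousLinearMap.comp_apply, smul_apply, innerSL_apply_apply,
    sub_apply, smul_eq_mul, smul_eq_mul, inv_mul_eq_div]
  rfl

/-- Away from the diagonal the joint derivative of `G` is bounded. -/
theorem exists_pairDeriv_green_le (hG : IsGreenFunction Ω G g) (hΩ : IsOpen Ω) {ε : ℝ}
    (hε : 0 < ε) : ∃ C : ℝ, ∀ x ∈ Ω, ∀ y ∈ Ω, ε ≤ ‖x - y‖ → ∀ u w : ℂ,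
      |pairDeriv G x y (u, w)| ≤ C * (‖u‖ + ‖w‖) := by
  obtain ⟨C, -, h⟩ := hG.bound_off_diag ε hε
  refine ⟨C, fun x hx y hy hxy u w => ?_⟩
  have hne : x ≠ y := by rintro rfl; simp at hxy; linarith
  have hd := hG.hasFDerivAt_green hΩ hx hy hne
  have h1 := h x hx y hy hxy
  rw [(hasFDerivAt_fst_variable hd).fderiv, (hasFDerivAt_snd_variable hd).fderiv] at h1
  have h0 := abs_nonneg (G x y)
  rw [pairDeriv_split]
  set A := (pairDeriv G x y).comp (.inl ℝ ℂ ℂ)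
  set B := (pairDeriv G x y).comp (.inr ℝ ℂ ℂ)
  calc |A u + B w| ≤ ‖A u‖ + ‖B w‖ := abs_add_le _ _
    _ ≤ ‖A‖ * ‖u‖ + ‖B‖ * ‖w‖ := add_le_add (A.le_opNorm u) (B.le_opNorm w)
    _ ≤ C * ‖u‖ + C * ‖w‖ := by
      have := norm_nonneg A
      have := norm_nonneg B
      gcongr <;> linarith
    _ = C * (‖u‖ + ‖w‖) := by ring

/-- Near a boundary point, the derivative of `g` is that of `(1 / 2π) ln |x̄ - y|` up to a bounded
term. -/
theorem exists_eventually_pairDeriv_sub_le (hG : IsGreenFunction Ω G g) (hΩ : IsOpen Ω)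
    (hC : HasC3Boundary Ω) {x₀ : ℂ} (h₀ : x₀ ∈ frontier Ω) :
    ∃ C : ℝ, ∀ᶠ p : ℂ × ℂ in 𝓝 (x₀, x₀), p.1 ∈ Ω → p.2 ∈ Ω → ∀ u w : ℂ,
      |pairDeriv g p.1 p.2 (u, w) - 1 / (2 * Real.pi) *
        (inner ℝ (reflect Ω p.1 - p.2) (fderiv ℝ (reflect Ω) p.1 u - w)
          / ‖reflect Ω p.1 - p.2‖ ^ 2)| ≤ C * (‖u‖ + ‖w‖) := by
  obtain ⟨ε, hε, C, -, h⟩ := hG.bound_reflect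
  refine ⟨C, ?_⟩
  have h1 : Tendsto Prod.fst (𝓝 (x₀, x₀)) (𝓝 x₀) := continuous_fst.tendsto (x₀, x₀)
  have h2 : Tendsto Prod.snd (𝓝 (x₀, x₀)) (𝓝 x₀) := continuous_snd.tendsto (x₀, x₀)
  have hcol : ∀ᶠ x in 𝓝 x₀, x ∈ Ω → x ∈ collar Ω ε := by
    filter_upwards [Metric.ball_mem_nhds x₀ hε] with x hx hxΩ
    refine ⟨hxΩ, (bdist_le h₀ x).trans_lt ?_⟩
    rwa [Metric.mem_ball, dist_eq_norm] at hx
  have hdiff : ∀ᶠ x in 𝓝 x₀, DifferentiableAt ℝ (reflect Ω) x :=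
    ((contDiffAt_reflect hΩ hC h₀).eventually (by simp)).mono
      fun x hx => hx.differentiableAt (by norm_num)
  filter_upwards [h1.eventually hcol, h2.eventually hcol, h1.eventually hdiff,
    eventually_bdist_le_norm_reflect_sub hΩ hC h₀] with ⟨x, y⟩ e1 e2 e3 e4 hx hy u w
  simp only at *
  have hpos : 0 < ‖reflect Ω x - y‖ := by
    have := bdist_pos hΩ ⟨x₀, h₀⟩ hx
    have := e4 hx hy
    linarith
  have hne := norm_pos_iff.1 hpos
  have hd := hG.hasFDerivAt_regular hΩ hx hy
  have hlx : HasFDerivAt (fun x' : ℂ => Real.log ‖reflect Ω x' - y‖) _ x :=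
    HasFDerivAt.comp x (f := fun x' : ℂ => reflect Ω x' - y) (hasFDerivAt_log_norm hne)
      (e3.hasFDerivAt.sub_const y)
  have hly : HasFDerivAt (fun y' : ℂ => Real.log ‖reflect Ω x - y'‖) _ y :=
    HasFDerivAt.comp y (f := fun y' : ℂ => reflect Ω x - y') (hasFDerivAt_log_norm hne)
      ((hasFDerivAt_id y).const_sub (reflect Ω x))
  have hψx := (hasFDerivAt_fst_variable hd).sub (hlx.const_mul (1 / (2 * Real.pi)))
  have hψy := (hasFDerivAt_snd_variable hd).sub (hly.const_mul (1 / (2 * Real.pi)))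
  have hb := h x (e1 hx) y (e2 hy)
  have hfx : fderiv ℝ (fun x' => reflectedPart Ω g x' y) x = _ := hψx.fderiv
  have hfy : fderiv ℝ (fun y' => reflectedPart Ω g x y') y = _ := hψy.fderiv
  have h0 := abs_nonneg (reflectedPart Ω g x y)
  set A := fderiv ℝ (fun x' => reflectedPart Ω g x' y) x
  set B := fderiv ℝ (fun y' => reflectedPart Ω g x y') y
  have hAB : pairDeriv g x y (u, w) - 1 / (2 * Real.pi) *
      (inner ℝ (reflect Ω x - y) (fderiv ℝ (reflect Ω) x u - w) / ‖reflect Ω x - y‖ ^ 2)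
      = A u + B w := by
    rw [hfx, hfy, pairDeriv_split, inner_sub_right]
    simp only [sub_apply, smul_apply, ContinuousLinearMap.comp_apply, innerSL_apply_apply,
      smul_eq_mul, neg_apply, ContinuousLinearMap.id_apply, inner_neg_right]
    ring
  rw [hAB]
  calc |A u + B w| ≤ ‖A u‖ + ‖B w‖ := abs_add_le _ _
    _ ≤ ‖A‖ * ‖u‖ + ‖B‖ * ‖w‖ := add_le_add (A.le_opNorm u) (B.le_opNorm w)
    _ ≤ C * ‖u‖ + C * ‖w‖ := by
      have := norm_nonneg A
      have := norm_nonneg B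
      gcongr <;> linarith
    _ = C * (‖u‖ + ‖w‖) := by ring

end IsGreenFunction

/-- Strict differentiability at `x₀`, in the form where the derivative is taken at a nearby
point. -/
theorem eventually_norm_fderiv_sub_le {f : ℂ → ℂ} {x₀ : ℂ} (hf : ContDiffAt ℝ 1 f x₀) {ε : ℝ}
    (hε : 0 < ε) : ∀ᶠ q : ℂ × ℂ in 𝓝 (x₀, x₀),
      ‖fderiv ℝ f q.1 (q.1 - q.2) - (f q.1 - f q.2)‖ ≤ ε * ‖q.1 - q.2‖ := by
  have h1 := (hf.hasStrictFDerivAt (by norm_num)).isLittleO.def (half_pos hε)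
  have h2 : ContinuousAt (fderiv ℝ f) x₀ :=
    (hf.fderiv_right (m := 0) (by norm_num)).continuousAt
  have h3 : ∀ᶠ x in 𝓝 x₀, ‖fderiv ℝ f x - fderiv ℝ f x₀‖ < ε / 2 := by
    have := h2.eventually (Metric.ball_mem_nhds _ (half_pos hε))
    simpa [dist_eq_norm] using this
  have h4 : Tendsto Prod.fst (𝓝 (x₀, x₀)) (𝓝 x₀) := continuous_fst.tendsto (x₀, x₀)
  filter_upwards [h1, h4.eventually h3] with ⟨x, p⟩ e1 e2
  simp only at *
  have e3 := (fderiv ℝ f x - fderiv ℝ f x₀).le_of_opNorm_le e2.le (x - p)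
  rw [sub_apply] at e3
  calc ‖fderiv ℝ f x (x - p) - (f x - f p)‖
      = ‖(fderiv ℝ f x (x - p) - fderiv ℝ f x₀ (x - p))
          - (f x - f p - fderiv ℝ f x₀ (x - p))‖ := by congr 1; abel
    _ ≤ ε / 2 * ‖x - p‖ + ε / 2 * ‖x - p‖ := (norm_sub_le _ _).trans (add_le_add e3 e1)
    _ = ε * ‖x - p‖ := by ring

theorem abs_inner_div_sq_le (h e : ℂ) : |inner ℝ h e / ‖h‖ ^ 2| ≤ ‖e‖ / ‖h‖ := by
  rcases eq_or_ne h 0 with rfl | hne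
  · simp
  have := norm_pos_iff.2 hne
  rw [abs_div, abs_of_nonneg (by positivity : 0 ≤ ‖h‖ ^ 2), div_le_div_iff₀ (by positivity) this]
  calc |inner ℝ h e| * ‖h‖ ≤ ‖h‖ * ‖e‖ * ‖h‖ := by gcongr; exact abs_real_inner_le_norm h e
    _ = ‖e‖ * ‖h‖ ^ 2 := by ring

/-! ### Limits of directional derivatives -/

namespace IsGreenFunction

variable {Ω : Set ℂ} {G g : ℂ → ℂ → ℝ} {α : Type*} {l : Filter α} {x y p u w : α → ℂ}

theorem tendsto_pairDeriv_regular (hG : IsGreenFunction Ω G g) (hΩ : IsOpen Ω) {a b : ℂ}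
    (ha : a ∈ Ω) (hb : b ∈ Ω) (hx : Tendsto x l (𝓝 a)) (hy : Tendsto y l (𝓝 b))
    (hu : Tendsto u l (𝓝 0)) (hw : Tendsto w l (𝓝 0)) :
    Tendsto (fun t => pairDeriv g (x t) (y t) (u t, w t)) l (𝓝 0) := by
  have h1 : ContinuousAt (fderiv ℝ fun p : ℂ × ℂ => g p.1 p.2) (a, b) :=
    ((hG.contDiffAt hΩ ha hb).fderiv_right (m := 0) (by norm_num)).continuousAt
  have h2 : Tendsto (fun t => pairDeriv g (x t) (y t)) l (𝓝 (pairDeriv g a b)) :=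
    h1.tendsto.comp (hx.prodMk_nhds hy)
  have h3 := (isBoundedBilinearMap_apply.continuous.tendsto
    (pairDeriv g a b, ((0 : ℂ), (0 : ℂ)))).comp (h2.prodMk_nhds (hu.prodMk_nhds hw))
  rw [Prod.mk_zero_zero, map_zero] at h3
  exact h3

theorem tendsto_pairDeriv_green_of_ne (hG : IsGreenFunction Ω G g) (hΩ : IsOpen Ω) {a b : ℂ}
    (hab : a ≠ b) (hx : Tendsto x l (𝓝 a)) (hy : Tendsto y l (𝓝 b))
    (hxΩ : ∀ᶠ t in l, x t ∈ Ω) (hyΩ : ∀ᶠ t in l, y t ∈ Ω)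
    (hu : Tendsto u l (𝓝 0)) (hw : Tendsto w l (𝓝 0)) :
    Tendsto (fun t => pairDeriv G (x t) (y t) (u t, w t)) l (𝓝 0) := by
  have hpos : 0 < ‖a - b‖ := norm_pos_iff.2 (sub_ne_zero.2 hab)
  obtain ⟨C, hC⟩ := hG.exists_pairDeriv_green_le hΩ (half_pos hpos)
  have hlim : Tendsto (fun t => C * (‖u t‖ + ‖w t‖)) l (𝓝 0) := by
    simpa using (hu.norm.add hw.norm).const_mul C
  refine squeeze_zero_norm' ?_ hlim
  filter_upwards [hxΩ, hyΩ, (hx.sub hy).norm.eventually (le_mem_nhds (half_lt_self hpos))]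
    with t h1 h2 h3
  exact hC _ h1 _ h2 h3 _ _

/-- `x` and `y` are moved by a dilation centred at the boundary point `p`, at the scale of the
distance of `x` to the boundary. The reflection fixes `p`, so to first order it is equivariant, and
`ln |x̄ - y|` grows at unit rate. -/
theorem tendsto_pairDeriv_dilation (hG : IsGreenFunction Ω G g) (hΩ : IsOpen Ω)
    (hC : HasC3Boundary Ω) {x₀ : ℂ} (h₀ : x₀ ∈ frontier Ω) (hx : Tendsto x l (𝓝 x₀))
    (hy : Tendsto y l (𝓝 x₀)) (hp : Tendsto p l (𝓝 x₀)) (hxΩ : ∀ᶠ t in l, x t ∈ Ω)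
    (hyΩ : ∀ᶠ t in l, y t ∈ Ω) (hpΩ : ∀ᶠ t in l, p t ∈ frontier Ω) {M : ℝ}
    (hM : ∀ᶠ t in l, ‖x t - p t‖ ≤ M * bdist Ω (x t)) :
    Tendsto (fun t => pairDeriv g (x t) (y t) (x t - p t, y t - p t)) l
      (𝓝 (1 / (2 * Real.pi))) := by
  obtain ⟨C, hC1⟩ := hG.exists_eventually_pairDeriv_sub_le hΩ hC h₀
  set r := reflect Ω
  let h : α → ℂ := fun t => r (x t) - y t
  let D : α → ℂ := fun t => fderiv ℝ r (x t) (x t - p t) - (y t - p t)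
  have hlim1 : Tendsto (fun t => pairDeriv g (x t) (y t) (x t - p t, y t - p t)
      - 1 / (2 * Real.pi) * (inner ℝ (h t) (D t) / ‖h t‖ ^ 2)) l (𝓝 0) := by
    have hlim : Tendsto (fun t => C * (‖x t - p t‖ + ‖y t - p t‖)) l (𝓝 0) := by
      simpa using ((hx.sub hp).norm.add (hy.sub hp).norm).const_mul C
    refine squeeze_zero_norm' ?_ hlim
    filter_upwards [(hx.prodMk_nhds hy).eventually hC1, hxΩ, hyΩ] with t e1 e2 e3
    exact e1 e2 e3 _ _
  have hlim2 : Tendsto (fun t => inner ℝ (h t) (D t) / ‖h t‖ ^ 2) l (𝓝 1) := by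
    rw [Metric.tendsto_nhds]
    intro ε hε
    have hη : 0 < ε / (8 * (|M| + 1)) := by positivity
    filter_upwards [(hx.prodMk_nhds hy).eventually (eventually_bdist_le_norm_reflect_sub hΩ hC h₀),
      (hx.prodMk_nhds hp).eventually
        (eventually_norm_fderiv_sub_le (contDiffAt_reflect hΩ hC h₀) hη),
      hxΩ, hyΩ, hpΩ, hM] with t e1 e2 e3 e4 e5 e6
    have e7 : bdist Ω (x t) ≤ 4 * ‖h t‖ := e1 e3 e4
    have hdpos := bdist_pos hΩ ⟨x₀, h₀⟩ e3
    have hhpos : 0 < ‖h t‖ := by linarith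
    set e := fderiv ℝ r (x t) (x t - p t) - (r (x t) - r (p t)) with he
    have hD : D t = h t + e := by
      simp only [D, h, he, r, reflect_of_mem_frontier e5]
      abel
    have e8 : ‖e‖ ≤ ε / 2 * ‖h t‖ := by
      have hM1 : ‖x t - p t‖ ≤ (|M| + 1) * (4 * ‖h t‖) :=
        e6.trans (mul_le_mul (by linarith [le_abs_self M]) e7 hdpos.le (by positivity))
      calc ‖e‖ ≤ ε / (8 * (|M| + 1)) * ‖x t - p t‖ := e2
        _ ≤ ε / (8 * (|M| + 1)) * ((|M| + 1) * (4 * ‖h t‖)) := by gcongr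
        _ = ε / 2 * ‖h t‖ := by field_simp; norm_num
    have e9 : inner ℝ (h t) (D t) / ‖h t‖ ^ 2 - 1 = inner ℝ (h t) e / ‖h t‖ ^ 2 := by
      rw [hD, inner_add_right, real_inner_self_eq_norm_sq]
      field_simp
      ring
    rw [Real.dist_eq, e9]
    calc |inner ℝ (h t) e / ‖h t‖ ^ 2| ≤ ‖e‖ / ‖h t‖ := abs_inner_div_sq_le _ _
      _ ≤ ε / 2 := (div_le_iff₀ hhpos).2 e8
      _ < ε := half_lt_self hε
  simpa using hlim1.add (hlim2.const_mul (1 / (2 * Real.pi)))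

/-- Two points near the boundary whose mutual distance is large compared to their displacements
interact weakly. -/
theorem tendsto_pairDeriv_green_of_far (hG : IsGreenFunction Ω G g) (hΩ : IsOpen Ω)
    (hC : HasC3Boundary Ω) {x₀ : ℂ} (h₀ : x₀ ∈ frontier Ω) (hx : Tendsto x l (𝓝 x₀))
    (hy : Tendsto y l (𝓝 x₀)) (hxΩ : ∀ᶠ t in l, x t ∈ Ω) (hyΩ : ∀ᶠ t in l, y t ∈ Ω)
    (hxy : ∀ᶠ t in l, x t ≠ y t) (hu : Tendsto u l (𝓝 0)) (hw : Tendsto w l (𝓝 0))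
    (huw : Tendsto (fun t => (‖u t‖ + ‖w t‖) / ‖x t - y t‖) l (𝓝 0)) :
    Tendsto (fun t => pairDeriv G (x t) (y t) (u t, w t)) l (𝓝 0) := by
  obtain ⟨C, hC1⟩ := hG.exists_eventually_pairDeriv_sub_le hΩ hC h₀
  have hcont : ContinuousAt (fderiv ℝ (reflect Ω)) x₀ :=
    ((contDiffAt_reflect hΩ hC h₀).fderiv_right (m := 0) (by norm_num)).continuousAt
  set K := ‖fderiv ℝ (reflect Ω) x₀‖ + 1 with hK
  have hK1 : 1 ≤ K := by simp [hK]
  have hKev : ∀ᶠ x in 𝓝 x₀, ‖fderiv ℝ (reflect Ω) x‖ < K :=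
    hcont.norm.eventually (gt_mem_nhds (by simp [hK]))
  have hπ : 0 < 1 / (2 * Real.pi) := by positivity
  have hlim : Tendsto (fun t => C * (‖u t‖ + ‖w t‖)
      + 1 / (2 * Real.pi) * (9 * K + 1) * ((‖u t‖ + ‖w t‖) / ‖x t - y t‖)) l (𝓝 0) := by
    simpa using ((hu.norm.add hw.norm).const_mul C).add
      (huw.const_mul (1 / (2 * Real.pi) * (9 * K + 1)))
  refine squeeze_zero_norm' ?_ hlim
  filter_upwards [(hx.prodMk_nhds hy).eventually hC1, hxΩ, hyΩ, hxy,
    (hx.prodMk_nhds hy).eventually (eventually_bdist_le_norm_reflect_sub hΩ hC h₀),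
    hx.eventually hKev] with t e1 e2 e3 e4 e5 e6
  have e5' : bdist Ω (x t) ≤ 4 * ‖reflect Ω (x t) - y t‖ := e5 e2 e3
  have hd0 := bdist_pos hΩ ⟨x₀, h₀⟩ e2
  set h := reflect Ω (x t) - y t with hh
  have hpos : 0 < ‖h‖ := by linarith
  have hxy0 : 0 < ‖x t - y t‖ := norm_pos_iff.2 (sub_ne_zero.2 e4)
  have e7 : ‖x t - y t‖ ≤ 9 * ‖h‖ := by
    have h1 := norm_reflect_sub ⟨x₀, h₀⟩ (x t)
    have h2 := norm_sub_le h (reflect Ω (x t) - x t)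
    rw [hh, sub_sub_sub_cancel_left, h1] at h2
    linarith
  have e8 := e1 e2 e3 (u t) (w t)
  set D := fderiv ℝ (reflect Ω) (x t) (u t) - w t
  have e9 : ‖D‖ ≤ K * (‖u t‖ + ‖w t‖) := by
    have h1 := (fderiv ℝ (reflect Ω) (x t)).le_of_opNorm_le e6.le (u t)
    have h2 := norm_sub_le (fderiv ℝ (reflect Ω) (x t) (u t)) (w t)
    have h3 := norm_nonneg (w t)
    nlinarith
  have e10 : |inner ℝ h D / ‖h‖ ^ 2| ≤ 9 * K * ((‖u t‖ + ‖w t‖) / ‖x t - y t‖) := by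
    refine (abs_inner_div_sq_le _ _).trans ?_
    rw [← mul_div_assoc, div_le_div_iff₀ hpos hxy0]
    calc ‖D‖ * ‖x t - y t‖ ≤ K * (‖u t‖ + ‖w t‖) * (9 * ‖h‖) := by gcongr
      _ = 9 * K * (‖u t‖ + ‖w t‖) * ‖h‖ := by ring
  have e11 : |inner ℝ (x t - y t) (u t - w t) / ‖x t - y t‖ ^ 2|
      ≤ (‖u t‖ + ‖w t‖) / ‖x t - y t‖ := by
    refine (abs_inner_div_sq_le _ _).trans ?_
    gcongr
    exact norm_sub_le _ _
  rw [hG.pairDeriv_green hΩ e2 e3 e4, Real.norm_eq_abs]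
  set P := pairDeriv g (x t) (y t) (u t, w t)
  set I := inner ℝ h D / ‖h‖ ^ 2
  set J := inner ℝ (x t - y t) (u t - w t) / ‖x t - y t‖ ^ 2
  set c := 1 / (2 * Real.pi)
  set S := (‖u t‖ + ‖w t‖) / ‖x t - y t‖
  calc |P - c * J| = |(P - c * I) + c * I - c * J| := by ring_nf
    _ ≤ |P - c * I| + |c * I| + |c * J| :=
      (abs_sub _ _).trans (add_le_add (abs_add_le _ _) le_rfl)
    _ ≤ C * (‖u t‖ + ‖w t‖) + c * (9 * K * S) + c * S := by
      rw [abs_mul, abs_mul, abs_of_pos hπ]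
      gcongr
    _ = C * (‖u t‖ + ‖w t‖) + c * (9 * K + 1) * S := by ring

end IsGreenFunction

/-! ### Differentiability of the Kirchhoff-Routh function -/

section KirchhoffRouth

variable {Ω : Set ℂ} {G g : ℂ → ℂ → ℝ} {N : ℕ}

theorem isOpen_configSpace (hΩ : IsOpen Ω) (N : ℕ) : IsOpen (configSpace Ω N) := by
  have : configSpace Ω N = (⋂ i, {z : Conf N | z i ∈ Ω}) ∩
      ⋂ i, ⋂ j, ⋂ _ : i ≠ j, {z : Conf N | z i ≠ z j} := by
    ext z; simp [configSpace]
  rw [this]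
  refine IsOpen.inter (isOpen_iInter_of_finite fun i => hΩ.preimage (by fun_prop)) ?_
  exact isOpen_iInter_of_finite fun i => isOpen_iInter_of_finite fun j =>
    isOpen_iInter_of_finite fun _ => isOpen_ne_fun (by fun_prop) (by fun_prop)

theorem contDiffAt_pair (z : Conf N) (i j : Fin N) :
    ContDiffAt ℝ 1 (fun z : Conf N => (z i, z j)) z :=
  ((PiLp.proj 2 (𝕜 := ℝ) (fun _ : Fin N => ℂ) i).contDiff.prodMk
    (PiLp.proj 2 (𝕜 := ℝ) (fun _ : Fin N => ℂ) j).contDiff).contDiffAt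

theorem hasFDerivAt_pair (z : Conf N) (i j : Fin N) :
    HasFDerivAt (fun z : Conf N => (z i, z j))
      ((PiLp.proj 2 (𝕜 := ℝ) (fun _ : Fin N => ℂ) i).prod
        (PiLp.proj 2 (𝕜 := ℝ) (fun _ : Fin N => ℂ) j)) z :=
  (PiLp.hasFDerivAt_apply 2 z i).prodMk (PiLp.hasFDerivAt_apply 2 z j)

theorem contDiffAt_kirchhoffRouth (hG : IsGreenFunction Ω G g) (hΩ : IsOpen Ω) (Γ : Fin N → ℝ)
    {z : Conf N} (hz : z ∈ configSpace Ω N) : ContDiffAt ℝ 1 (kirchhoffRouth G g Γ) z := by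
  refine ContDiffAt.add (ContDiffAt.sum fun j _ => contDiffAt_const.mul ?_)
    (ContDiffAt.sum fun i _ => ContDiffAt.sum fun j hj => contDiffAt_const.mul ?_)
  · exact ContDiffAt.comp z (f := fun z : Conf N => (z j, z j))
      (hG.contDiffAt hΩ (hz.1 j) (hz.1 j)) (contDiffAt_pair z j j)
  · exact ContDiffAt.comp z (f := fun z : Conf N => (z i, z j))
      (hG.contDiffAt_green hΩ (hz.1 i) (hz.1 j) (hz.2 i j (Finset.mem_filter.1 hj).2.symm))
      (contDiffAt_pair z i j)

theorem fderiv_kirchhoffRouth (hG : IsGreenFunction Ω G g) (hΩ : IsOpen Ω) (Γ : Fin N → ℝ)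
    {z : Conf N} (hz : z ∈ configSpace Ω N) (v : Conf N) :
    fderiv ℝ (kirchhoffRouth G g Γ) z v =
      ∑ j, Γ j ^ 2 * pairDeriv g (z j) (z j) (v j, v j) +
        ∑ i, ∑ j ∈ Finset.univ.filter (fun j => j ≠ i),
          Γ i * Γ j * pairDeriv G (z i) (z j) (v i, v j) := by
  have h1 : ∀ j, HasFDerivAt (fun z : Conf N => Γ j ^ 2 * g (z j) (z j)) _ z := fun j =>
    (HasFDerivAt.comp z (f := fun z : Conf N => (z j, z j))
      (hG.hasFDerivAt_regular hΩ (hz.1 j) (hz.1 j)) (hasFDerivAt_pair z j j)).const_mul (Γ j ^ 2)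
  have h2 : ∀ i j, j ∈ Finset.univ.filter (fun j => j ≠ i) →
      HasFDerivAt (fun z : Conf N => Γ i * Γ j * G (z i) (z j)) _ z := fun i j hj =>
    (HasFDerivAt.comp z (f := fun z : Conf N => (z i, z j))
      (hG.hasFDerivAt_green hΩ (hz.1 i) (hz.1 j) (hz.2 i j (Finset.mem_filter.1 hj).2.symm))
      (hasFDerivAt_pair z i j)).const_mul (Γ i * Γ j)
  have h3 : HasFDerivAt (kirchhoffRouth G g Γ) _ z :=
    (HasFDerivAt.fun_sum fun j _ => h1 j).add
      (HasFDerivAt.fun_sum fun i _ => HasFDerivAt.fun_sum (h2 i))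
  rw [h3.fderiv]
  simp

theorem hasGradientAt_kirchhoffRouth (hG : IsGreenFunction Ω G g) (hΩ : IsOpen Ω) (Γ : Fin N → ℝ)
    {z : Conf N} (hz : z ∈ configSpace Ω N) :
    HasGradientAt (kirchhoffRouth G g Γ) (gradient (kirchhoffRouth G g Γ) z) z :=
  ((contDiffAt_kirchhoffRouth hG hΩ Γ hz).differentiableAt (by norm_num)).hasGradientAt

theorem continuousAt_gradient_kirchhoffRouth (hG : IsGreenFunction Ω G g) (hΩ : IsOpen Ω)
    (Γ : Fin N → ℝ) {z : Conf N} (hz : z ∈ configSpace Ω N) :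
    ContinuousAt (gradient (kirchhoffRouth G g Γ)) z :=
  (toDual ℝ (Conf N)).symm.continuous.continuousAt.comp
    ((contDiffAt_kirchhoffRouth hG hΩ Γ hz).fderiv_right (m := 0) (by norm_num)).continuousAt

/-- Termwise limits of the derivative of the Kirchhoff-Routh function along test vectors. -/
theorem tendsto_fderiv_kirchhoffRouth (hG : IsGreenFunction Ω G g) (hΩ : IsOpen Ω)
    (Γ : Fin N → ℝ) {l : Filter (Conf N)} (hl : ∀ᶠ z in l, z ∈ configSpace Ω N)
    {v : Conf N → Conf N} {S : Fin N → ℝ} {P : Fin N → Fin N → ℝ}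
    (hS : ∀ j, Tendsto (fun z => pairDeriv g (z j) (z j) (v z j, v z j)) l (𝓝 (S j)))
    (hP : ∀ i j, i ≠ j →
      Tendsto (fun z => pairDeriv G (z i) (z j) (v z i, v z j)) l (𝓝 (P i j))) :
    Tendsto (fun z => fderiv ℝ (kirchhoffRouth G g Γ) z (v z)) l
      (𝓝 (∑ j, Γ j ^ 2 * S j +
        ∑ i, ∑ j ∈ Finset.univ.filter (fun j => j ≠ i), Γ i * Γ j * P i j)) := by
  have h : Tendsto (fun z => ∑ j, Γ j ^ 2 * pairDeriv g (z j) (z j) (v z j, v z j) +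
        ∑ i, ∑ j ∈ Finset.univ.filter (fun j => j ≠ i),
          Γ i * Γ j * pairDeriv G (z i) (z j) (v z i, v z j)) l
      (𝓝 (∑ j, Γ j ^ 2 * S j +
        ∑ i, ∑ j ∈ Finset.univ.filter (fun j => j ≠ i), Γ i * Γ j * P i j)) :=
    (tendsto_finsetSum _ fun j _ => (hS j).const_mul _).add
      (tendsto_finsetSum _ fun i _ => tendsto_finsetSum _ fun j hj =>
        (hP i j (Finset.mem_filter.1 hj).2.symm).const_mul _)
  refine h.congr' ?_
  filter_upwards [hl] with z hz
  exact (fderiv_kirchhoffRouth hG hΩ Γ hz (v z)).symm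

end KirchhoffRouth

/-! ### Blow-up of the gradient at singular configurations -/

theorem abs_fderiv_apply_le {N : ℕ} (H : Conf N → ℝ) (z v : Conf N) :
    |fderiv ℝ H z v| ≤ ‖gradient H z‖ * ‖v‖ := by
  rw [← toDual_gradient, toDual_apply_apply]
  exact abs_real_inner_le_norm _ _

/-- Test vectors of size `O(‖z - a‖)` along which the derivative of `H` has a nonzero limit
contradict `‖∇H z‖ = o(1 / ‖z - a‖)`. -/
theorem eq_zero_of_tendsto_fderiv {N : ℕ} {H : Conf N → ℝ} {a : Conf N} {l : Filter (Conf N)}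
    [l.NeBot] (h0 : Tendsto (fun z => ‖gradient H z‖ * ‖z - a‖) l (𝓝 0)) {v : Conf N → Conf N}
    {K A : ℝ} (hv : ∀ᶠ z in l, ∀ i, ‖v z i‖ ≤ K * ‖z - a‖)
    (hA : Tendsto (fun z => fderiv ℝ H z (v z)) l (𝓝 A)) : A = 0 := by
  refine tendsto_nhds_unique hA ?_
  have hlim : Tendsto (fun z => √N * K * (‖gradient H z‖ * ‖z - a‖)) l (𝓝 0) := by
    simpa using h0.const_mul (√N * K)
  refine squeeze_zero_norm' ?_ hlim
  filter_upwards [hv] with z hz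
  have hvz : ‖v z‖ ≤ √N * (K * ‖z - a‖) := by
    rcases isEmpty_or_nonempty (Fin N) with hN | ⟨⟨i⟩⟩
    · rw [Subsingleton.elim (v z) 0, Subsingleton.elim (z - a) 0]
      simp
    have hnn : 0 ≤ K * ‖z - a‖ := (norm_nonneg _).trans (hz i)
    rw [EuclideanSpace.norm_eq]
    refine Real.sqrt_le_iff.2 ⟨by positivity, ?_⟩
    calc ∑ i, ‖v z i‖ ^ 2 ≤ ∑ _i : Fin N, (K * ‖z - a‖) ^ 2 :=
          Finset.sum_le_sum fun i _ => pow_le_pow_left₀ (norm_nonneg _) (hz i) 2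
      _ = (√N * (K * ‖z - a‖)) ^ 2 := by
          rw [mul_pow √(N : ℝ), Real.sq_sqrt (Nat.cast_nonneg N)]; simp
  calc ‖fderiv ℝ H z (v z)‖ ≤ ‖gradient H z‖ * ‖v z‖ := abs_fderiv_apply_le H z (v z)
    _ ≤ ‖gradient H z‖ * (√N * (K * ‖z - a‖)) := by gcongr
    _ = √N * K * (‖gradient H z‖ * ‖z - a‖) := by ring

theorem tendsto_coord {N : ℕ} {a : Conf N} {l : Filter (Conf N)} (hl : l ≤ 𝓝 a) (i : Fin N) :
    Tendsto (fun z : Conf N => z i) l (𝓝 (a i)) := by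
  have : Continuous fun z : Conf N => z i := by fun_prop
  exact (this.tendsto a).mono_left hl

open Classical in
/-- The configuration of displacements from `q z` of the points of a cluster `C`; the other points
do not move. -/
noncomputable def clusterVector {N : ℕ} (C : Finset (Fin N)) (q : Conf N → ℂ) (z : Conf N) :
    Conf N :=
  WithLp.toLp 2 fun i => if i ∈ C then z i - q z else 0

section ClusterVector

variable {N : ℕ} {C : Finset (Fin N)} {q : Conf N → ℂ} {z : Conf N} {i : Fin N}

theorem clusterVector_of_mem (hi : i ∈ C) : clusterVector C q z i = z i - q z := by
  simp [clusterVector, hi]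

theorem clusterVector_of_notMem (hi : i ∉ C) : clusterVector C q z i = 0 := by
  simp [clusterVector, hi]

theorem tendsto_clusterVector {a : Conf N} {l : Filter (Conf N)} (hl : l ≤ 𝓝 a) {x₀ : ℂ}
    (hC : ∀ i ∈ C, a i = x₀) (hq : Tendsto q l (𝓝 x₀)) (i : Fin N) :
    Tendsto (fun z => clusterVector C q z i) l (𝓝 0) := by
  by_cases hi : i ∈ C
  · have h := (tendsto_coord hl i).sub hq
    rw [hC i hi, sub_self] at h
    simpa only [clusterVector_of_mem hi] using h
  · simp only [clusterVector_of_notMem hi, tendsto_const_nhds]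

end ClusterVector

section BlowUp

variable {Ω : Set ℂ} {G g : ℂ → ℂ → ℝ} {N : ℕ}

/-- Along an ultrafilter, one fixed member of a finite family of real functions is minimal. -/
theorem exists_eventually_le_of_ultrafilter {α ι : Type*} (𝒰 : Ultrafilter α) {C : Finset ι}
    (hC : C.Nonempty) (d : ι → α → ℝ) :
    ∃ m ∈ C, ∀ᶠ z in (𝒰 : Filter α), ∀ i ∈ C, d m z ≤ d i z := by
  have h : (⋃ m ∈ (C : Set ι), {z | ∀ i ∈ C, d m z ≤ d i z}) ∈ 𝒰 := by
    refine univ_mem' fun z => ?_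
    obtain ⟨m, hm, h⟩ := C.exists_min_image (fun i => d i z) hC
    exact Set.mem_biUnion hm h
  exact (Ultrafilter.finite_biUnion_mem_iff C.finite_toSet).1 h

/-- A collision at the interior point `x₀`: the dilation about `x₀` of the colliding points changes
`H` at a rate that tends to `-(1 / 2π) ∑ Γ i Γ j`. -/
theorem not_tendsto_of_interior_collision (hG : IsGreenFunction Ω G g) (hΩ : IsOpen Ω)
    {Γ : Fin N → ℝ} (hdiag : DiagAdmissible Γ) {a : Conf N} {l : Filter (Conf N)} [l.NeBot]
    (hla : l ≤ 𝓝 a) (hlF : ∀ᶠ z in l, z ∈ configSpace Ω N) {i₀ j₀ : Fin N} (hij : i₀ ≠ j₀)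
    (ha : a i₀ = a j₀) (haΩ : a i₀ ∈ Ω)
    (h0 : Tendsto (fun z => ‖gradient (kirchhoffRouth G g Γ) z‖ * ‖z - a‖) l (𝓝 0)) : False := by
  set x₀ := a i₀ with hx₀
  set C : Finset (Fin N) := Finset.univ.filter fun i => a i = x₀ with hCdef
  have hCmem : ∀ i, i ∈ C ↔ a i = x₀ := fun i => by simp [hCdef]
  set v : Conf N → Conf N := clusterVector C fun _ => x₀
  have hv0 : ∀ i, Tendsto (fun z => v z i) l (𝓝 0) :=
    tendsto_clusterVector hla (fun i hi => (hCmem i).1 hi) tendsto_const_nhds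
  have hvle : ∀ᶠ z in l, ∀ i, ‖v z i‖ ≤ 1 * ‖z - a‖ := Eventually.of_forall fun z i => by
    by_cases hi : i ∈ C
    · rw [clusterVector_of_mem hi, one_mul, ← (hCmem i).1 hi]
      exact PiLp.norm_apply_le (z - a) i
    · rw [clusterVector_of_notMem hi]
      simp
  have hS : ∀ j, Tendsto (fun z => pairDeriv g (z j) (z j) (v z j, v z j)) l (𝓝 0) := fun j => by
    by_cases hj : j ∈ C
    · have hz := tendsto_coord hla j
      rw [(hCmem j).1 hj] at hz
      exact hG.tendsto_pairDeriv_regular hΩ haΩ haΩ hz hz (hv0 j) (hv0 j)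
    · simp only [v, clusterVector_of_notMem hj, Prod.mk_zero_zero, map_zero, tendsto_const_nhds]
  have hP : ∀ i j, i ≠ j → Tendsto (fun z => pairDeriv G (z i) (z j) (v z i, v z j)) l
      (𝓝 (if i ∈ C ∧ j ∈ C then -(1 / (2 * Real.pi)) else 0)) := fun i j hne => by
    by_cases haij : a i = a j
    · by_cases hi : i ∈ C
      · have hj : j ∈ C := (hCmem j).2 (haij ▸ (hCmem i).1 hi)
        rw [if_pos ⟨hi, hj⟩]
        have hzi := tendsto_coord hla i
        have hzj := tendsto_coord hla j
        rw [(hCmem i).1 hi] at hzi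
        rw [(hCmem j).1 hj] at hzj
        have h1 := (hG.tendsto_pairDeriv_regular hΩ haΩ haΩ hzi hzj (hv0 i) (hv0 j)).sub_const
          (1 / (2 * Real.pi))
        rw [zero_sub] at h1
        refine h1.congr' ?_
        filter_upwards [hlF] with z hz
        have hzij := hz.2 i j hne
        rw [hG.pairDeriv_green hΩ (hz.1 i) (hz.1 j) hzij, clusterVector_of_mem hi,
          clusterVector_of_mem hj, sub_sub_sub_cancel_right, real_inner_self_eq_norm_sq, div_self,
          mul_one]
        exact pow_ne_zero 2 (norm_ne_zero_iff.2 (sub_ne_zero.2 hzij))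
      · have hj : j ∉ C := fun hj => hi ((hCmem i).2 (haij.trans ((hCmem j).1 hj)))
        simp only [v, clusterVector_of_notMem hi, clusterVector_of_notMem hj, Prod.mk_zero_zero,
          map_zero, hi, false_and, if_false, tendsto_const_nhds]
    · rw [if_neg fun h => haij (((hCmem i).1 h.1).trans ((hCmem j).1 h.2).symm)]
      exact hG.tendsto_pairDeriv_green_of_ne hΩ haij (tendsto_coord hla i) (tendsto_coord hla j)
        (hlF.mono fun z hz => hz.1 i) (hlF.mono fun z hz => hz.1 j) (hv0 i) (hv0 j)
  have hA := eq_zero_of_tendsto_fderiv h0 hvle (tendsto_fderiv_kirchhoffRouth hG hΩ Γ hlF hS hP)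
  have hcard : 2 ≤ C.card := Finset.one_lt_card.2
    ⟨i₀, (hCmem i₀).2 rfl, j₀, (hCmem j₀).2 ha.symm, hij⟩
  refine hdiag C hcard ?_
  have hsum : ∑ i, ∑ j ∈ Finset.univ.filter (fun j => j ≠ i),
      Γ i * Γ j * (if i ∈ C ∧ j ∈ C then -(1 / (2 * Real.pi)) else 0)
      = -(1 / (2 * Real.pi)) * ∑ i ∈ C, ∑ j ∈ C.filter (fun j => j ≠ i), Γ i * Γ j := by
    simp_rw [Finset.sum_filter, Finset.mul_sum]
    rw [← Finset.sum_subset (Finset.subset_univ C)]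
    · refine Finset.sum_congr rfl fun i hi => ?_
      rw [← Finset.sum_subset (Finset.subset_univ C)]
      · refine Finset.sum_congr rfl fun j hj => ?_
        simp only [hi, hj, and_self, if_true, mul_ite, mul_zero]
        split_ifs <;> ring
      · intro j _ hj
        simp [hj]
    · intro i _ hi
      simp [hi]
  rw [hsum] at hA
  have hπ : (1 / (2 * Real.pi)) ≠ 0 := by positivity
  simpa [hπ, Real.pi_ne_zero] using hA

/-- Points converging to the boundary point `x₀`: among them choose the point `z m` nearest to the
boundary and the cluster of the points at distance `O(d(z m))` from it, and dilate that cluster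
about the projection of `z m`. The pair interactions within the cluster are invariant, those with
the other points are negligible, and each Robin term changes at unit rate, so that `H` changes at a
rate that tends to `(1 / 2π) ∑ (Γ i) ^ 2`. -/
theorem not_tendsto_of_boundary_limit (hG : IsGreenFunction Ω G g) (hΩ : IsOpen Ω)
    (hC3 : HasC3Boundary Ω) {Γ : Fin N → ℝ} (hΓ : ∀ i, Γ i ≠ 0) {a : Conf N}
    (𝒰 : Ultrafilter (Conf N)) (hla : (𝒰 : Filter (Conf N)) ≤ 𝓝 a)
    (hlF : ∀ᶠ z in (𝒰 : Filter (Conf N)), z ∈ configSpace Ω N) {i₀ : Fin N}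
    (ha : a i₀ ∈ frontier Ω)
    (h0 : Tendsto (fun z => ‖gradient (kirchhoffRouth G g Γ) z‖ * ‖z - a‖) 𝒰 (𝓝 0)) : False := by
  classical
  set x₀ := a i₀ with hx₀
  set l : Filter (Conf N) := (𝒰 : Filter (Conf N))
  set C : Finset (Fin N) := Finset.univ.filter fun i => a i = x₀ with hCdef
  have hCmem : ∀ i, i ∈ C ↔ a i = x₀ := fun i => by simp [hCdef]
  have hlim : ∀ i ∈ C, Tendsto (fun z : Conf N => z i) l (𝓝 x₀) := fun i hi => by
    have := tendsto_coord hla i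
    rwa [(hCmem i).1 hi] at this
  have hzΩ : ∀ i, ∀ᶠ z in l, z i ∈ Ω := fun i => hlF.mono fun z hz => hz.1 i
  obtain ⟨m, hmC, hm⟩ := exists_eventually_le_of_ultrafilter 𝒰 ⟨i₀, (hCmem i₀).2 rfl⟩
    fun i (z : Conf N) => bdist Ω (z i)
  let d : Conf N → ℝ := fun z => bdist Ω (z m)
  let p : Conf N → ℂ := fun z => proj Ω (z m)
  have hd : ∀ᶠ z in l, 0 < d z := (hzΩ m).mono fun z hz => bdist_pos hΩ ⟨x₀, ha⟩ hz
  have hp : Tendsto p l (𝓝 x₀) := (tendsto_proj ha).comp (hlim m hmC)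
  have hpΩ : ∀ z, p z ∈ frontier Ω := fun z => (proj_spec ⟨x₀, ha⟩ (z m)).1
  have hpd : ∀ z, ‖z m - p z‖ = d z := fun z => by
    rw [norm_sub_rev]; exact (proj_spec ⟨x₀, ha⟩ (z m)).2
  set B : Finset (Fin N) := C.filter fun i => ∃ M : ℝ, ∀ᶠ z in l, ‖z i - z m‖ ≤ M * d z with hB
  have hBC : ∀ i ∈ B, i ∈ C := fun i hi => (Finset.mem_filter.1 hi).1
  have hmB : m ∈ B := Finset.mem_filter.2 ⟨hmC, 0, Eventually.of_forall fun z => by simp⟩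
  obtain ⟨M, hM⟩ : ∃ M : ℝ, ∀ i ∈ B, ∀ᶠ z in l, ‖z i - z m‖ ≤ M * d z := by
    have h1 : ∀ i, ∃ M : ℝ, i ∈ B → ∀ᶠ z in l, ‖z i - z m‖ ≤ M * d z := fun i => by
      by_cases hi : i ∈ B
      · obtain ⟨M, hM⟩ := (Finset.mem_filter.1 hi).2
        exact ⟨M, fun _ => hM⟩
      · exact ⟨0, fun h => absurd h hi⟩
    choose M hM using h1
    obtain ⟨M', hM'⟩ := (B.image M).exists_le
    refine ⟨M', fun i hi => ?_⟩
    filter_upwards [hM i hi, hd] with z h2 h3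
    exact h2.trans (mul_le_mul_of_nonneg_right (hM' _ (Finset.mem_image_of_mem M hi)) h3.le)
  have hMp : ∀ i ∈ B, ∀ᶠ z in l, ‖z i - p z‖ ≤ (|M| + 1) * d z := fun i hi => by
    filter_upwards [hM i hi, hd] with z h2 h3
    have h4 := norm_sub_le_norm_sub_add_norm_sub (z i) (z m) (p z)
    rw [hpd] at h4
    nlinarith [le_abs_self M]
  -- along an ultrafilter, failing to be `O(d)` means being large compared to `d`: the points
  -- outside the cluster are far away at the scale `d`
  have hfar : ∀ i ∈ B, ∀ j ∈ C, j ∉ B → ∀ K : ℝ, ∀ᶠ z in l, K * d z ≤ ‖z i - z j‖ := by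
    intro i hi j hj hjB K
    have h1 : ¬ ∀ᶠ z in l, ‖z j - z m‖ ≤ (K + M) * d z :=
      fun h => hjB (Finset.mem_filter.2 ⟨hj, _, h⟩)
    filter_upwards [Ultrafilter.eventually_not.2 h1, hM i hi] with z h2 h3
    have h4 := norm_sub_le_norm_sub_add_norm_sub (z j) (z i) (z m)
    rw [norm_sub_rev (z j) (z i)] at h4
    linarith [not_le.1 h2]
  set v : Conf N → Conf N := clusterVector B p
  have hv0 : ∀ i, Tendsto (fun z => v z i) l (𝓝 0) :=
    tendsto_clusterVector hla (fun i hi => (hCmem i).1 (hBC i hi)) hp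
  have hvM : ∀ i, ∀ᶠ z in l, ‖v z i‖ ≤ (|M| + 1) * d z := fun i => by
    by_cases hi : i ∈ B
    · simpa only [v, clusterVector_of_mem hi] using hMp i hi
    · filter_upwards [hd] with z hz
      simp only [v, clusterVector_of_notMem hi, norm_zero]
      positivity
  have hvle : ∀ᶠ z in l, ∀ i, ‖v z i‖ ≤ (|M| + 1) * ‖z - a‖ := by
    filter_upwards [eventually_all.2 hvM] with z hz i
    refine (hz i).trans (mul_le_mul_of_nonneg_left ?_ (by positivity))
    have h1 := bdist_le ha (z m)
    rw [← (hCmem m).1 hmC] at h1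
    exact h1.trans (PiLp.norm_apply_le (z - a) m)
  have hdil : ∀ i ∈ B, ∀ j ∈ B, Tendsto (fun z => pairDeriv g (z i) (z j) (v z i, v z j)) l
      (𝓝 (1 / (2 * Real.pi))) := fun i hi j hj => by
    simp only [v, clusterVector_of_mem hi, clusterVector_of_mem hj]
    refine hG.tendsto_pairDeriv_dilation hΩ hC3 ha (hlim i (hBC i hi)) (hlim j (hBC j hj)) hp
      (hzΩ i) (hzΩ j) (Eventually.of_forall hpΩ) (M := |M| + 1) ?_
    filter_upwards [hMp i hi, hm] with z h1 h2
    exact h1.trans (mul_le_mul_of_nonneg_left (h2 i (hBC i hi)) (by positivity))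
  have hS : ∀ j, Tendsto (fun z => pairDeriv g (z j) (z j) (v z j, v z j)) l
      (𝓝 (if j ∈ B then 1 / (2 * Real.pi) else 0)) := fun j => by
    by_cases hj : j ∈ B
    · rw [if_pos hj]
      exact hdil j hj j hj
    · simp only [v, clusterVector_of_notMem hj, Prod.mk_zero_zero, map_zero, hj, if_false,
        tendsto_const_nhds]
  have hratio : ∀ i j, i ≠ j → (∀ K : ℝ, ∀ᶠ z in l, K * d z ≤ ‖z i - z j‖) →
      Tendsto (fun z => (‖v z i‖ + ‖v z j‖) / ‖z i - z j‖) l (𝓝 0) := by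
    intro i j hne hK
    rw [Metric.tendsto_nhds]
    intro ε hε
    filter_upwards [hK (4 * (|M| + 1) / ε), hvM i, hvM j, hd, hlF] with z h1 h2 h3 h4 h5
    have hpos : 0 < ‖z i - z j‖ := norm_pos_iff.2 (sub_ne_zero.2 (h5.2 i j hne))
    rw [Real.dist_eq, sub_zero, abs_of_nonneg (by positivity)]
    have h6 : (‖v z i‖ + ‖v z j‖) / ‖z i - z j‖ ≤ ε / 2 := by
      rw [div_le_iff₀ hpos]
      calc ‖v z i‖ + ‖v z j‖ ≤ ε / 2 * (4 * (|M| + 1) / ε * d z) := by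
            have : ε / 2 * (4 * (|M| + 1) / ε * d z) = 2 * ((|M| + 1) * d z) := by
              field_simp; norm_num
            linarith
        _ ≤ ε / 2 * ‖z i - z j‖ := by gcongr
    linarith
  have hP : ∀ i j, i ≠ j →
      Tendsto (fun z => pairDeriv G (z i) (z j) (v z i, v z j)) l (𝓝 0) := fun i j hne => by
    have hweak : i ∈ C → j ∈ C → (∀ K : ℝ, ∀ᶠ z in l, K * d z ≤ ‖z i - z j‖) →
        Tendsto (fun z => pairDeriv G (z i) (z j) (v z i, v z j)) l (𝓝 0) := fun hi hj hK =>
      hG.tendsto_pairDeriv_green_of_far hΩ hC3 ha (hlim i hi) (hlim j hj) (hzΩ i) (hzΩ j)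
        (hlF.mono fun z hz => hz.2 i j hne) (hv0 i) (hv0 j) (hratio i j hne hK)
    by_cases haij : a i = a j
    · by_cases hi : i ∈ B <;> by_cases hj : j ∈ B
      · have h1 := (hdil i hi j hj).sub_const (1 / (2 * Real.pi))
        rw [sub_self] at h1
        refine h1.congr' ?_
        filter_upwards [hlF] with z hz
        have hzij := hz.2 i j hne
        rw [hG.pairDeriv_green hΩ (hz.1 i) (hz.1 j) hzij, clusterVector_of_mem hi,
          clusterVector_of_mem hj, sub_sub_sub_cancel_right, real_inner_self_eq_norm_sq, div_self,
          mul_one]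
        exact pow_ne_zero 2 (norm_ne_zero_iff.2 (sub_ne_zero.2 hzij))
      · have hjC : j ∈ C := (hCmem j).2 (haij ▸ (hCmem i).1 (hBC i hi))
        exact hweak (hBC i hi) hjC (hfar i hi j hjC hj)
      · have hiC : i ∈ C := (hCmem i).2 (haij.trans ((hCmem j).1 (hBC j hj)))
        refine hweak hiC (hBC j hj) fun K => ?_
        simpa only [norm_sub_rev] using hfar j hj i hiC hi K
      · simp only [v, clusterVector_of_notMem hi, clusterVector_of_notMem hj, Prod.mk_zero_zero,
          map_zero, tendsto_const_nhds]
    · exact hG.tendsto_pairDeriv_green_of_ne hΩ haij (tendsto_coord hla i) (tendsto_coord hla j)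
        (hzΩ i) (hzΩ j) (hv0 i) (hv0 j)
  have hA := eq_zero_of_tendsto_fderiv h0 hvle
    (tendsto_fderiv_kirchhoffRouth hG hΩ Γ hlF hS (P := fun _ _ => 0) hP)
  simp only [mul_zero, Finset.sum_const_zero, add_zero] at hA
  rw [Finset.sum_eq_zero_iff_of_nonneg] at hA
  · have := hA m (Finset.mem_univ m)
    rw [if_pos hmB] at this
    have hπ : (1 / (2 * Real.pi)) ≠ 0 := by positivity
    exact mul_ne_zero (pow_ne_zero 2 (hΓ m)) hπ this
  · intro i _
    split_ifs <;> positivity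

/-- The gradient of `H` blows up at least like the inverse of the distance to a singular
configuration. -/
theorem exists_le_norm_gradient_mul (hΩ : IsOpen Ω) (hC3 : HasC3Boundary Ω)
    (hG : IsGreenFunction Ω G g) {Γ : Fin N → ℝ} (hΓ : ∀ i, Γ i ≠ 0) (hdiag : DiagAdmissible Γ)
    {a : Conf N} (hcl : ∀ i, a i ∈ closure Ω) (ha : a ∉ configSpace Ω N) :
    ∃ c : ℝ, 0 < c ∧ ∀ᶠ z in 𝓝[configSpace Ω N] a,
      c ≤ ‖gradient (kirchhoffRouth G g Γ) z‖ * ‖z - a‖ := by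
  by_contra! hcon
  have hmap : MapClusterPt (0 : ℝ) (𝓝[configSpace Ω N] a)
      fun z => ‖gradient (kirchhoffRouth G g Γ) z‖ * ‖z - a‖ := by
    rw [mapClusterPt_iff_frequently]
    intro s hs
    obtain ⟨c, hc, hcs⟩ := Metric.mem_nhds_iff.1 hs
    refine (hcon c hc).mono fun z hz => hcs ?_
    rw [Metric.mem_ball, dist_zero_right, Real.norm_of_nonneg (by positivity)]
    exact hz
  obtain ⟨𝒰, h𝒰, h0⟩ := mapClusterPt_iff_ultrafilter.1 hmap
  have hla : (𝒰 : Filter (Conf N)) ≤ 𝓝 a := h𝒰.trans nhdsWithin_le_nhds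
  have hlF : ∀ᶠ z in (𝒰 : Filter (Conf N)), z ∈ configSpace Ω N := h𝒰 self_mem_nhdsWithin
  by_cases hint : ∀ i, a i ∈ Ω
  · obtain ⟨i, j, hij, haij⟩ : ∃ i j, i ≠ j ∧ a i = a j := by
      by_contra! h
      exact ha ⟨hint, h⟩
    exact not_tendsto_of_interior_collision hG hΩ hdiag hla hlF hij haij (hint i) h0
  · push Not at hint
    obtain ⟨i, hi⟩ := hint
    refine not_tendsto_of_boundary_limit hG hΩ hC3 hΓ 𝒰 hla hlF (i₀ := i) ?_ h0
    rw [hΩ.frontier_eq]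
    exact ⟨hcl i, hi⟩

end BlowUp

/-! ### Peano's existence theorem -/

section Peano

variable {E : Type*} [NormedAddCommGroup E] [NormedSpace ℝ E]

/-- The explicit Euler scheme of step `h` for `y' = f y`, started at `x₀`. -/
def eulerSeq (f : E → E) (x₀ : E) (h : ℝ) : ℕ → E
  | 0 => x₀
  | k + 1 => eulerSeq f x₀ h k + h • f (eulerSeq f x₀ h k)

/-- If `f` stays within `η` of `w` along the scheme, then the scheme moves with velocity `w` up to
an error `η` per unit of time. -/
theorem norm_eulerSeq_sub_sub_le (f : E → E) (x₀ : E) {h : ℝ} (hh : 0 ≤ h) {η : ℝ} (w : E)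
    {k l : ℕ} (hkl : k ≤ l) (hw : ∀ i, k ≤ i → i ≤ l → ‖f (eulerSeq f x₀ h i) - w‖ ≤ η) :
    ‖eulerSeq f x₀ h l - eulerSeq f x₀ h k - (((l : ℝ) - k) * h) • w‖ ≤ ((l : ℝ) - k) * h * η := by
  induction l, hkl using Nat.le_induction with
  | base => simp
  | succ l hkl ih =>
    have h1 := ih fun i hi hil => hw i hi (hil.trans (Nat.le_succ l))
    have h2 := hw l hkl (Nat.le_succ l)
    set u := eulerSeq f x₀ h
    have h3 : u (l + 1) = u l + h • f (u l) := rfl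
    have h4 : u (l + 1) - u k - ((((l + 1 : ℕ) : ℝ) - k) * h) • w
        = (u l - u k - (((l : ℝ) - k) * h) • w) + h • (f (u l) - w) := by
      rw [h3]
      push_cast
      module
    rw [h4]
    calc _ ≤ ((l : ℝ) - k) * h * η + h * η := by
          refine (norm_add_le _ _).trans (add_le_add h1 ?_)
          rw [norm_smul, Real.norm_of_nonneg hh]
          gcongr
      _ = _ := by push_cast; ring

variable [ProperSpace E]

/-- Peano's existence theorem for a bounded, uniformly continuous vector field. The solution is a
pointwise limit of Euler schemes along an ultrafilter: the estimates that express the equation are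
uniform in the step and therefore pass to the limit. -/
theorem exists_global_solution {f : E → E} (hf : UniformContinuous f) {M : ℝ}
    (hM : ∀ x, ‖f x‖ ≤ M) (x₀ : E) : ∃ y : ℝ → E, y 0 = x₀ ∧
      ∀ t, 0 ≤ t → HasDerivWithinAt y (f (y t)) (Set.Ici 0) t := by
  have hM0 : 0 ≤ M := (norm_nonneg _).trans (hM x₀)
  set 𝒰 : Filter ℕ := (hyperfilter ℕ : Filter ℕ)
  let κ : ℕ → ℝ → ℕ := fun n t => ⌊t * ((n : ℝ) + 1)⌋₊
  let h : ℕ → ℝ := fun n => ((n : ℝ) + 1)⁻¹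
  have hh : ∀ n, 0 ≤ h n := fun n => by positivity
  let u : ℕ → ℝ → E := fun n t => eulerSeq f x₀ (h n) (κ n t)
  have hκ : ∀ t, 0 ≤ t → Tendsto (fun n => (κ n t : ℝ) * h n) 𝒰 (𝓝 t) := fun t ht =>
    ((tendsto_nat_floor_mul_div_atTop ht).comp
      (tendsto_natCast_atTop_atTop.atTop_add tendsto_const_nhds)).mono_left
        Nat.hyperfilter_le_atTop
  have hκmono : ∀ n s t, s ≤ t → κ n s ≤ κ n t := fun n s t hst =>
    Nat.floor_le_floor (by gcongr)
  have hlip : ∀ n k l, k ≤ l → ‖eulerSeq f x₀ (h n) l - eulerSeq f x₀ (h n) k‖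
      ≤ ((l : ℝ) - k) * h n * M := fun n k l hkl => by
    have := norm_eulerSeq_sub_sub_le f x₀ (hh n) 0 hkl (η := M) fun i _ _ => by
      rw [sub_zero]; exact hM _
    rwa [smul_zero, sub_zero] at this
  have hlim : ∀ t, ∃ y, Tendsto (fun n => u n t) 𝒰 (𝓝 y) := fun t => by
    have hmem : ∀ n, u n t ∈ Metric.closedBall x₀ (|t| * M) := fun n => by
      rw [mem_closedBall_iff_norm]
      refine (hlip n 0 (κ n t) (Nat.zero_le _)).trans ?_
      rw [Nat.cast_zero, sub_zero]
      refine mul_le_mul_of_nonneg_right ?_ hM0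
      have hn : (0 : ℝ) < (n : ℝ) + 1 := by positivity
      rw [← div_eq_mul_inv, div_le_iff₀ hn]
      calc (κ n t : ℝ) ≤ ⌊|t| * ((n : ℝ) + 1)⌋₊ := by
            refine Nat.cast_le.2 (Nat.floor_le_floor ?_)
            exact mul_le_mul_of_nonneg_right (le_abs_self t) hn.le
        _ ≤ |t| * ((n : ℝ) + 1) := Nat.floor_le (by positivity)
    obtain ⟨y, -, hy⟩ := (isCompact_closedBall x₀ (|t| * M)).ultrafilter_le_nhds'
      ((hyperfilter ℕ).map fun n => u n t) (Ultrafilter.mem_map.2 (univ_mem' hmem))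
    exact ⟨y, hy⟩
  choose y hy using hlim
  have hylip : ∀ s t, 0 ≤ s → s ≤ t → ‖y t - y s‖ ≤ (t - s) * M := fun s t hs hst => by
    refine le_of_tendsto_of_tendsto ((hy t).sub (hy s)).norm
      (((hκ t (hs.trans hst)).sub (hκ s hs)).mul_const M) (Eventually.of_forall fun n => ?_)
    have := hlip n _ _ (hκmono n s t hst)
    rwa [sub_mul] at this
  have hyder : ∀ η, 0 < η → ∃ δ, 0 < δ ∧ ∀ s t, 0 ≤ s → s ≤ t → (t - s) * M < δ →
      ‖y t - y s - (t - s) • f (y s)‖ ≤ (t - s) * η := by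
    intro η hη
    obtain ⟨δ, hδ, hfδ⟩ := Metric.uniformContinuous_iff.1 hf η hη
    refine ⟨δ, hδ, fun s t hs hst hlt => ?_⟩
    have hts := (hκ t (hs.trans hst)).sub (hκ s hs)
    refine le_of_tendsto_of_tendsto ((((hy t).sub (hy s)).sub
      (hts.smul ((hf.continuous.tendsto _).comp (hy s)))).norm) (hts.mul_const η) ?_
    filter_upwards [(hts.mul_const M).eventually (gt_mem_nhds hlt)] with n hn
    have := norm_eulerSeq_sub_sub_le f x₀ (hh n) (f (u n s)) (hκmono n s t hst) (η := η) ?_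
    · rwa [sub_mul] at this
    · intro i hi hil
      rw [← dist_eq_norm]
      refine (hfδ ?_).le
      rw [dist_eq_norm]
      refine (hlip n _ i hi).trans_lt (lt_of_le_of_lt ?_ hn)
      rw [← sub_mul]
      have : (i : ℝ) ≤ κ n t := by exact_mod_cast hil
      have := hh n
      gcongr
  refine ⟨y, ?_, fun t ht => ?_⟩
  · refine tendsto_nhds_unique (hy 0) ?_
    have : ∀ n, u n 0 = x₀ := fun n => by simp [u, κ, eulerSeq]
    simp only [this, tendsto_const_nhds]
  · rw [hasDerivWithinAt_iff_isLittleO, Asymptotics.isLittleO_iff]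
    intro ε hε
    obtain ⟨δ₁, hδ₁, h1⟩ := hyder (ε / 2) (half_pos hε)
    obtain ⟨δ₂, hδ₂, h2⟩ := Metric.uniformContinuous_iff.1 hf (ε / 2) (half_pos hε)
    have hball : ∀ᶠ s in 𝓝 t, |s - t| * M < min δ₁ δ₂ := by
      have hc : Continuous fun s : ℝ => |s - t| * M := by fun_prop
      have := hc.tendsto t
      simp only [sub_self, abs_zero, zero_mul] at this
      exact this.eventually (gt_mem_nhds (lt_min hδ₁ hδ₂))
    filter_upwards [hball.filter_mono nhdsWithin_le_nhds, self_mem_nhdsWithin] with s hs hs0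
    obtain ⟨hs1, hs2⟩ := lt_min_iff.1 hs
    rcases le_total t s with hts | hst
    · rw [abs_of_nonneg (sub_nonneg.2 hts)] at hs1
      rw [Real.norm_of_nonneg (sub_nonneg.2 hts)]
      refine (h1 t s ht hts hs1).trans ?_
      have := sub_nonneg.2 hts
      nlinarith
    · rw [abs_sub_comm, abs_of_nonneg (sub_nonneg.2 hst)] at hs1 hs2
      rw [norm_sub_rev s t, Real.norm_of_nonneg (sub_nonneg.2 hst)]
      have h3 := h1 s t hs0 hst hs1
      have h4 : ‖f (y s) - f (y t)‖ ≤ ε / 2 := by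
        rw [← dist_eq_norm]
        refine (h2 ?_).le
        rw [dist_comm, dist_eq_norm]
        exact (hylip s t hs0 hst).trans_lt hs2
      have h5 : y s - y t - (s - t) • f (y t)
          = -(y t - y s - (t - s) • f (y s)) - (t - s) • (f (y s) - f (y t)) := by module
      rw [h5]
      calc _ ≤ (t - s) * (ε / 2) + (t - s) * (ε / 2) := by
            refine (norm_sub_le _ _).trans (add_le_add (by rwa [norm_neg]) ?_)
            rw [norm_smul, Real.norm_of_nonneg (sub_nonneg.2 hst)]
            exact mul_le_mul_of_nonneg_left h4 (sub_nonneg.2 hst)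
        _ = ε * (t - s) := by ring

/-- Peano's existence theorem: a continuous vector field on an open set has a local solution
through each of its points. -/
theorem exists_local_solution {E : Type*} [NormedAddCommGroup E] [InnerProductSpace ℝ E]
    [FiniteDimensional ℝ E] {F : Set E} (hF : IsOpen F) {f : E → E} (hf : ContinuousOn f F) {a : E}
    (ha : a ∈ F) : ∃ (δ : ℝ) (y : ℝ → E), 0 < δ ∧ y 0 = a ∧
      ∀ t, 0 ≤ t → t < δ → y t ∈ F ∧ HasDerivWithinAt y (f (y t)) (Set.Ici 0) t := by
  obtain ⟨R, hR, hRF⟩ := Metric.nhds_basis_closedBall.mem_iff.1 (hF.mem_nhds ha)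
  let b : ContDiffBump a := ⟨R / 2, R, half_pos hR, half_lt_self hR⟩
  have hcont : Continuous fun x => b x • f x := by
    refine continuous_iff_continuousAt.2 fun x => ?_
    by_cases hx : x ∈ tsupport b
    · rw [b.tsupport_eq] at hx
      exact b.continuous.continuousAt.smul (hf.continuousAt (hF.mem_nhds (hRF hx)))
    · have h0 : ContinuousAt (fun _ : E => (0 : E)) x := continuousAt_const
      refine h0.congr ?_
      filter_upwards [notMem_tsupport_iff_eventuallyEq.1 hx] with z hz
      simp [hz]
  have hsupp : HasCompactSupport fun x => b x • f x := b.hasCompactSupport.smul_right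
  obtain ⟨M, hM⟩ := hsupp.exists_bound_of_continuous hcont
  have : ProperSpace E := FiniteDimensional.proper ℝ E
  obtain ⟨y, hy0, hy⟩ :=
    exists_global_solution (hsupp.uniformContinuous_of_continuous hcont) hM a
  have hyc : ∀ᶠ t in 𝓝[Set.Ici 0] (0 : ℝ), y t ∈ Metric.closedBall a (R / 2) := by
    refine (hy 0 le_rfl).continuousWithinAt.eventually ?_
    rw [hy0]
    exact Metric.closedBall_mem_nhds a (half_pos hR)
  obtain ⟨δ, hδ, hsub⟩ := (mem_nhdsGE_iff_exists_Ico_subset).1 hyc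
  refine ⟨δ, y, hδ, hy0, fun t ht htδ => ?_⟩
  have hmem : y t ∈ Metric.closedBall a (R / 2) := hsub ⟨ht, htδ⟩
  refine ⟨hRF (Metric.closedBall_subset_closedBall (half_le_self hR.le) hmem), ?_⟩
  have h1 := hy t ht
  rwa [b.one_of_mem_closedBall hmem, one_smul] at h1

end Peano

/-! ### Gradient flow lines -/

section FlowLines

variable {N : ℕ} {F : Set (Conf N)} {H : Conf N → ℝ} {z : ℝ → Conf N} {T : EReal}

theorem le_of_hasDerivWithinAt_nonneg {φ φ' : ℝ → ℝ} {s t : ℝ} (hs : 0 ≤ s) (hst : s ≤ t)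
    (hd : ∀ x ∈ Set.Icc s t, HasDerivWithinAt φ (φ' x) (Set.Ici 0) x)
    (h0 : ∀ x ∈ Set.Icc s t, 0 ≤ φ' x) : φ s ≤ φ t := by
  have hsub : Set.Icc s t ⊆ Set.Ici 0 := fun x hx => hs.trans hx.1
  refine monotoneOn_of_hasDerivWithinAt_nonneg (convex_Icc s t)
    (fun x hx => ((hd x hx).mono hsub).continuousWithinAt)
    (fun x hx => (hd x (interior_subset hx)).mono (interior_subset.trans hsub))
    (fun x hx => h0 x (interior_subset hx)) ⟨le_rfl, hst⟩ ⟨hst, le_rfl⟩ hst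

theorem IsFlowLine.hasDerivWithinAt_comp (hz : IsFlowLine F H z T)
    (hH : ∀ x ∈ F, HasGradientAt H (gradient H x) x) {t : ℝ} (ht : 0 ≤ t) (htT : (t : EReal) < T) :
    HasDerivWithinAt (fun t => H (z t)) (‖gradient H (z t)‖ ^ 2) (Set.Ici 0) t := by
  obtain ⟨h1, h2⟩ := hz.2 t ht htT
  have h3 := (hH _ h1).hasFDerivAt.comp_hasDerivWithinAt t h2
  rwa [InnerProductSpace.toDual_apply_apply, real_inner_self_eq_norm_sq] at h3

theorem IsFlowLine.le_of_le (hz : IsFlowLine F H z T)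
    (hH : ∀ x ∈ F, HasGradientAt H (gradient H x) x) {s t : ℝ} (hs : 0 ≤ s) (hst : s ≤ t)
    (htT : (t : EReal) < T) : H (z s) ≤ H (z t) :=
  le_of_hasDerivWithinAt_nonneg (φ := fun t => H (z t)) hs hst
    (fun _ hx => hz.hasDerivWithinAt_comp hH (hs.trans hx.1)
      ((EReal.coe_le_coe_iff.2 hx.2).trans_lt htT)) fun _ _ => sq_nonneg _

/-- Since `‖∇H‖ ≤ (1 + ‖∇H‖²) / 2`, the length of a flow line is controlled by the elapsed time and
by the increase of `H`. -/
theorem IsFlowLine.norm_sub_le (hz : IsFlowLine F H z T)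
    (hH : ∀ x ∈ F, HasGradientAt H (gradient H x) x) {s t : ℝ} (hs : 0 ≤ s) (hst : s ≤ t)
    (htT : (t : EReal) < T) : ‖z t - z s‖ ≤ ((t - s) + (H (z t) - H (z s))) / 2 := by
  have hT : ∀ x ∈ Set.Icc s t, (x : EReal) < T := fun x hx =>
    (EReal.coe_le_coe_iff.2 hx.2).trans_lt htT
  have hsub : Set.Icc s t ⊆ Set.Ici 0 := fun x hx => hs.trans hx.1
  have hd : ∀ x ∈ Set.Icc s t, HasDerivWithinAt (fun x => z x - z s) (gradient H (z x))
      (Set.Ici 0) x := fun x hx => ((hz.2 x (hs.trans hx.1) (hT x hx)).2).sub_const (z s)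
  have hB : ∀ x ∈ Set.Icc s t, HasDerivWithinAt (fun x => ((x - s) + (H (z x) - H (z s))) / 2)
      ((1 + ‖gradient H (z x)‖ ^ 2) / 2) (Set.Ici 0) x := fun x hx =>
    ((((hasDerivAt_id x).hasDerivWithinAt).sub_const s).add
      ((hz.hasDerivWithinAt_comp hH (hs.trans hx.1) (hT x hx)).sub_const (H (z s)))).div_const 2
  refine image_norm_le_of_norm_deriv_right_le_deriv_boundary'
    (f := fun x => z x - z s) (f' := fun x => gradient H (z x))
    (B := fun x => ((x - s) + (H (z x) - H (z s))) / 2)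
    (fun x hx => ((hd x hx).mono hsub).continuousWithinAt)
    (fun x hx => (hd x (Set.Ico_subset_Icc_self hx)).mono (Set.Ici_subset_Ici.2 (hs.trans hx.1)))
    (by simp)
    (fun x hx => ((hB x hx).mono hsub).continuousWithinAt)
    (fun x hx => (hB x (Set.Ico_subset_Icc_self hx)).mono (Set.Ici_subset_Ici.2 (hs.trans hx.1)))
    (fun x _ => ?_) ⟨hst, le_rfl⟩
  nlinarith [sq_nonneg (‖gradient H (z x)‖ - 1)]

theorem atTop_le_toEnd : atTop ≤ toEnd ⊤ := by
  refine map_le_iff_le_comap.1 (tendsto_nhdsWithin_iff.2 ⟨?_, ?_⟩)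
  · exact EReal.tendsto_coe_nhds_top_iff.2 tendsto_id
  · exact Eventually.of_forall fun t => EReal.coe_lt_top t

theorem nhdsLT_le_toEnd (r : ℝ) : 𝓝[<] r ≤ toEnd (r : EReal) := by
  refine map_le_iff_le_comap.1 (tendsto_nhdsWithin_iff.2 ⟨?_, ?_⟩)
  · exact (continuous_coe_real_ereal.tendsto r).mono_left nhdsWithin_le_nhds
  · exact eventually_mem_nhdsWithin.mono fun t ht => EReal.coe_lt_coe_iff.2 ht

/-- A flow line in finite time along which `H` stays bounded converges. -/
theorem IsFlowLine.exists_tendsto {r c : ℝ} (hz : IsFlowLine F H z r)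
    (hH : ∀ x ∈ F, HasGradientAt H (gradient H x) x)
    (hc : Tendsto (fun t => H (z t)) (𝓝[<] r) (𝓝 c)) : ∃ a, Tendsto z (𝓝[<] r) (𝓝 a) := by
  have hr : 0 < r := EReal.coe_pos.1 hz.1
  refine cauchy_map_iff_exists_tendsto.1 (Metric.cauchy_iff.2 ⟨inferInstance, fun ε hε => ?_⟩)
  have h1 : ∀ᶠ t in 𝓝[<] r, dist (H (z t)) c < ε / 4 :=
    hc.eventually (Metric.ball_mem_nhds c (by positivity))
  have h2 : ∀ᶠ t in 𝓝[<] r, r - ε / 4 < t :=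
    (lt_mem_nhds (by linarith)).filter_mono nhdsWithin_le_nhds
  have h3 : ∀ᶠ t in 𝓝[<] r, 0 < t := (lt_mem_nhds hr).filter_mono nhdsWithin_le_nhds
  have h4 : ∀ᶠ t in 𝓝[<] r, t < r := eventually_mem_nhdsWithin
  refine ⟨_, image_mem_map ((h1.and h2).and (h3.and h4)), ?_⟩
  have key : ∀ s t, dist (H (z s)) c < ε / 4 → dist (H (z t)) c < ε / 4 → r - ε / 4 < s → 0 < s →
      t < r → s ≤ t → dist (z t) (z s) < ε := by
    intro s t hs ht hsr hs0 htr hst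
    have h := hz.norm_sub_le hH hs0.le hst (EReal.coe_lt_coe_iff.2 htr)
    rw [Real.dist_eq, abs_lt] at hs ht
    rw [dist_eq_norm]
    linarith
  rintro _ ⟨s, ⟨⟨a1, a2⟩, a3, a4⟩, rfl⟩ _ ⟨t, ⟨⟨b1, b2⟩, b3, b4⟩, rfl⟩
  rcases le_total s t with hst | hst
  · rw [dist_comm]
    exact key s t a1 b1 a2 a3 b4 hst
  · exact key t s b1 a1 b2 b3 a4 hst

/-- A flow line cannot reach in finite time, with `H` bounded, a point `a` outside `F` at which
`‖∇H‖` blows up at least like `c / ‖z - a‖`: otherwise `H + c log ‖z - a‖` would be nondecreasing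
and tend to `-∞`. -/
theorem IsFlowLine.limit_mem {r c : ℝ} (hz : IsFlowLine F H z r)
    (hH : ∀ x ∈ F, HasGradientAt H (gradient H x) x)
    (hc : Tendsto (fun t => H (z t)) (𝓝[<] r) (𝓝 c)) {a : Conf N}
    (ha : Tendsto z (𝓝[<] r) (𝓝 a))
    (hblow : a ∉ F → ∃ c : ℝ, 0 < c ∧ ∀ᶠ x in 𝓝[F] a, c ≤ ‖gradient H x‖ * ‖x - a‖) : a ∈ F := by
  by_contra haF
  obtain ⟨k, hk, hev⟩ := hblow haF
  have hr : 0 < r := EReal.coe_pos.1 hz.1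
  have hF : ∀ t, 0 ≤ t → t < r → z t ∈ F := fun t h0 h1 => (hz.2 t h0 (EReal.coe_lt_coe_iff.2 h1)).1
  have hpos : ∀ᶠ t in 𝓝[<] r, 0 < t := (lt_mem_nhds hr).filter_mono nhdsWithin_le_nhds
  have hlt : ∀ᶠ t in 𝓝[<] r, t < r := eventually_mem_nhdsWithin
  have haF' : Tendsto z (𝓝[<] r) (𝓝[F] a) := tendsto_nhdsWithin_iff.2
    ⟨ha, (hpos.and hlt).mono fun t ht => hF t ht.1.le ht.2⟩
  obtain ⟨t₀, ht₀, hsub⟩ := (mem_nhdsLT_iff_exists_Ioo_subset).1 (haF'.eventually hev)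
  obtain ⟨t₁, ht₁, ht₁r⟩ := exists_between (max_lt ht₀ hr)
  have h01 : 0 < t₁ := (le_max_right _ _).trans_lt ht₁
  have h00 : t₀ < t₁ := (le_max_left _ _).trans_lt ht₁
  -- the last term is `k log ‖z - a‖`, written with the differentiable squared norm
  let φ : ℝ → ℝ := fun t => H (z t) + k / 2 * Real.log (‖z t - a‖ ^ 2)
  have hne : ∀ t, 0 ≤ t → t < r → 0 < ‖z t - a‖ := fun t h0 h1 =>
    norm_pos_iff.2 (sub_ne_zero.2 fun h => haF (h ▸ hF t h0 h1))
  have hmono : ∀ t, t₁ ≤ t → t < r → φ t₁ ≤ φ t := by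
    intro t ht htr
    refine le_of_hasDerivWithinAt_nonneg (φ := φ) (φ' := fun x => ‖gradient H (z x)‖ ^ 2 + k / 2 *
      (2 * inner ℝ (z x - a) (gradient H (z x)) / ‖z x - a‖ ^ 2)) h01.le ht (fun x hx => ?_)
      fun x hx => ?_
    · have hx0 : 0 ≤ x := h01.le.trans hx.1
      have hxr : x < r := hx.2.trans_lt htr
      have hxT := EReal.coe_lt_coe_iff.2 hxr
      have h1 := ((hz.2 x hx0 hxT).2.sub_const a).norm_sq
      exact (hz.hasDerivWithinAt_comp hH hx0 hxT).add
        ((h1.log (pow_ne_zero 2 (hne x hx0 hxr).ne')).const_mul (k / 2))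
    · have hx0 : 0 ≤ x := h01.le.trans hx.1
      have hxr : x < r := hx.2.trans_lt htr
      have h1 : k ≤ ‖gradient H (z x)‖ * ‖z x - a‖ := hsub ⟨h00.trans_le hx.1, hxr⟩
      have h2 := hne x hx0 hxr
      have h3 := neg_le_of_abs_le (abs_real_inner_le_norm (z x - a) (gradient H (z x)))
      set A := ‖gradient H (z x)‖
      set R := ‖z x - a‖
      set I := inner ℝ (z x - a) (gradient H (z x))
      have hA : 0 ≤ A := norm_nonneg _
      have h4 : A ^ 2 + k / 2 * (2 * I / R ^ 2) = (A ^ 2 * R ^ 2 + k * I) / R ^ 2 := by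
        field_simp
      rw [h4]
      refine div_nonneg ?_ (by positivity)
      have h5 : k * (A * R) ≤ (A * R) * (A * R) := by gcongr
      nlinarith
  have hlog : Tendsto (fun t => Real.log (‖z t - a‖ ^ 2)) (𝓝[<] r) atBot := by
    refine Real.tendsto_log_nhdsGT_zero.comp (tendsto_nhdsWithin_iff.2 ⟨?_, ?_⟩)
    · have := ((ha.sub_const a).norm).pow 2
      simpa using this
    · exact (hpos.and hlt).mono fun t ht => pow_pos (hne t ht.1.le ht.2) 2
  have hφ : Tendsto φ (𝓝[<] r) atBot :=
    hc.add_atBot ((tendsto_const_mul_atBot_of_pos (half_pos hk)).2 hlog)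
  have h1 : ∀ᶠ t in 𝓝[<] r, t₁ ≤ t := (le_mem_nhds ht₁r).filter_mono nhdsWithin_le_nhds
  obtain ⟨t, ⟨ht1, ht2⟩, ht3⟩ := ((h1.and hlt).and (hφ.eventually_lt_atBot (φ t₁))).exists
  exact (hmono t ht1 ht2).not_gt ht3

/-- A flow line that converges in finite time inside the open set `F` is not maximal. -/
theorem IsMaximalFlowLine.limit_notMem {r : ℝ} (hz : IsMaximalFlowLine F H z r) (hF : IsOpen F)
    (hcont : ContinuousOn (gradient H) F) {a : Conf N} (ha : Tendsto z (𝓝[<] r) (𝓝 a)) :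
    a ∉ F := by
  intro haF
  have hr : 0 < r := EReal.coe_pos.1 hz.1.1
  obtain ⟨δ, y, hδ, hy0, hy⟩ := exists_local_solution hF hcont haF
  let Y : ℝ → Conf N := fun t => if t < r then z t else y (t - r)
  have hYlt : ∀ t, t < r → Y t = z t := fun t ht => if_pos ht
  have hYge : ∀ t, r ≤ t → Y t = y (t - r) := fun t ht => if_neg (not_lt.2 ht)
  have hYr : Y r = a := by rw [hYge r le_rfl, sub_self, hy0]
  have hzd : ∀ t, 0 ≤ t → t < r → z t ∈ F ∧ HasDerivWithinAt Y (gradient H (z t)) (Set.Ici 0) t :=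
    fun t h0 h1 => by
      obtain ⟨h2, h3⟩ := hz.1.2 t h0 (EReal.coe_lt_coe_iff.2 h1)
      refine ⟨h2, h3.congr_of_eventuallyEq ?_ (hYlt t h1)⟩
      filter_upwards [(gt_mem_nhds h1 : ∀ᶠ s in 𝓝 t, s < r).filter_mono nhdsWithin_le_nhds]
        with s hs using hYlt s hs
  have hyd : ∀ t, r ≤ t → t < r + δ →
      y (t - r) ∈ F ∧ HasDerivWithinAt Y (gradient H (y (t - r))) (Set.Ici r) t := fun t h0 h1 => by
    obtain ⟨h2, h3⟩ := hy (t - r) (by linarith) (by linarith)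
    have h4 := h3.scomp t (s := Set.Ici r) ((hasDerivAt_id t).sub_const r).hasDerivWithinAt
      (fun s hs => by simpa using hs)
    rw [one_smul] at h4
    exact ⟨h2, h4.congr (fun s hs => hYge s hs) (hYge t h0)⟩
  -- at the junction, the derivative from the left is the limit of the derivatives
  have hleft : HasDerivWithinAt Y (gradient H a) (Set.Iic r) r := by
    have hd : ∀ t ∈ Set.Ioo 0 r, HasDerivAt Y (gradient H (z t)) t := fun t ht =>
      (hzd t ht.1.le ht.2).2.hasDerivAt (Ici_mem_nhds ht.1)
    have hev : ∀ᶠ t in 𝓝[<] r, t ∈ Set.Ioo 0 r := Ioo_mem_nhdsLT hr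
    refine hasDerivWithinAt_Iic_of_tendsto_deriv (s := Set.Ioo 0 r)
      (fun t ht => (hd t ht).differentiableAt.differentiableWithinAt) ?_ hev ?_
    · have h1 : Tendsto Y (𝓝[<] r) (𝓝 (Y r)) := by
        rw [hYr]
        exact ha.congr' (eventually_mem_nhdsWithin.mono fun t ht => (hYlt t ht).symm)
      exact h1.mono_left (nhdsWithin_mono r Set.Ioo_subset_Iio_self)
    · have h1 : Tendsto (fun t => gradient H (z t)) (𝓝[<] r) (𝓝 (gradient H a)) :=
        (hcont.continuousAt (hF.mem_nhds haF)).tendsto.comp ha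
      exact h1.congr' (hev.mono fun t ht => (hd t ht).deriv.symm)
  have hflow : IsFlowLine F H Y ((r + δ : ℝ) : EReal) := by
    refine ⟨EReal.coe_pos.2 (by linarith), fun t h0 hT => ?_⟩
    have hT' : t < r + δ := EReal.coe_lt_coe_iff.1 hT
    rcases lt_trichotomy t r with h | rfl | h
    · rw [hYlt t h]
      exact hzd t h0 h
    · have h1 := (hyd t le_rfl hT').2
      rw [sub_self, hy0] at h1
      rw [hYr]
      have h2 := hleft.union h1
      rw [Set.Iic_union_Ici] at h2
      exact ⟨haF, h2.mono (Set.subset_univ _)⟩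
    · rw [hYge t h.le]
      obtain ⟨h1, h2⟩ := hyd t h.le hT'
      exact ⟨h1, (h2.hasDerivAt (Ici_mem_nhds h)).hasDerivWithinAt⟩
  have hle := hz.2 Y _ hflow fun t _ ht => hYlt t (EReal.coe_lt_coe_iff.1 ht)
  have := EReal.coe_le_coe_iff.1 hle
  linarith

/-- Along a global flow line with `H` bounded above, the gradient is small at arbitrarily late
times. -/
theorem IsFlowLine.exists_norm_gradient_lt (hz : IsFlowLine F H z ⊤)
    (hH : ∀ x ∈ F, HasGradientAt H (gradient H x) x) {c : ℝ} (hc : ∀ t, 0 ≤ t → H (z t) ≤ c)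
    {ε : ℝ} (hε : 0 < ε) {t₀ : ℝ} (ht₀ : 0 ≤ t₀) :
    ∃ s, t₀ ≤ s ∧ ‖gradient H (z s)‖ < ε := by
  by_contra! hcon
  set t := t₀ + (c - H (z t₀) + 1) / ε ^ 2 with ht
  have hc0 := hc t₀ ht₀
  have hle : t₀ ≤ t := le_add_of_nonneg_right (div_nonneg (by linarith) (by positivity))
  have h1 : H (z t₀) - ε ^ 2 * t₀ ≤ H (z t) - ε ^ 2 * t := by
    refine le_of_hasDerivWithinAt_nonneg (φ := fun t => H (z t) - ε ^ 2 * t)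
      (φ' := fun t => ‖gradient H (z t)‖ ^ 2 - ε ^ 2 * 1) ht₀ hle (fun x hx => ?_) fun x hx => ?_
    · exact (hz.hasDerivWithinAt_comp hH (ht₀.trans hx.1) (EReal.coe_lt_top x)).sub
        (((hasDerivAt_id x).const_mul (ε ^ 2)).hasDerivWithinAt)
    · have h2 := pow_le_pow_left₀ hε.le (hcon x hx.1) 2
      linarith
  have h2 : ε ^ 2 * t = ε ^ 2 * t₀ + (c - H (z t₀) + 1) := by
    rw [ht]
    field_simp
  have h3 := hc t (ht₀.trans hle)
  linarith

end FlowLines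

/-! ### Compactness -/

section Compactness

variable {Ω : Set ℂ} {N : ℕ}

theorem exists_subseq_tendsto (hΩ : Bornology.IsBounded Ω) (u : ℕ → Conf N)
    (hu : ∀ n, u n ∈ configSpace Ω N) : ∃ a : Conf N, (∀ i, a i ∈ closure Ω) ∧
      ∃ k : ℕ → ℕ, StrictMono k ∧ Tendsto (fun n => u (k n)) atTop (𝓝 a) := by
  have hK : IsCompact (Set.univ.pi fun _ : Fin N => closure Ω) :=
    isCompact_univ_pi fun _ => hΩ.isCompact_closure
  obtain ⟨b, hb, k, hk, hlim⟩ := hK.tendsto_subseq (x := fun n i => u n i)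
    fun n i _ => subset_closure ((hu n).1 i)
  refine ⟨WithLp.toLp 2 b, fun i => hb i trivial, k, hk, ?_⟩
  exact ((PiLp.continuous_toLp 2 (fun _ : Fin N => ℂ)).tendsto b).comp hlim

/-- A limit of configurations that are closer and closer to the singular set is singular. -/
theorem notMem_configSpace_of_nearSingular (hΩ : IsOpen Ω) (hne : (frontier Ω).Nonempty)
    {u : ℕ → Conf N} {δ : ℕ → ℝ} (hδ : Tendsto δ atTop (𝓝 0))
    (hu : ∀ n, u n ∈ nearSingular Ω N (δ n)) {a : Conf N} (ha : Tendsto u atTop (𝓝 a)) :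
    a ∉ configSpace Ω N := by
  intro haF
  have hcoord : ∀ i, Tendsto (fun n => u n i) atTop (𝓝 (a i)) := fun i =>
    (tendsto_coord le_rfl i).comp ha
  have h1 : ∀ᶠ n in atTop, ∀ i j, i ≠ j → δ n < ‖u n i - u n j‖ := by
    refine eventually_all.2 fun i => eventually_all.2 fun j => ?_
    by_cases hij : i = j
    · simp [hij]
    · have hpos : 0 < ‖a i - a j‖ := norm_pos_iff.2 (sub_ne_zero.2 (haF.2 i j hij))
      filter_upwards [hδ.eventually_lt ((hcoord i).sub (hcoord j)).norm hpos] with n hn _ using hn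
  have h2 : ∀ᶠ n in atTop, ∀ j, δ n < bdist Ω (u n j) := by
    refine eventually_all.2 fun j => ?_
    have hb : Tendsto (fun n => bdist Ω (u n j)) atTop (𝓝 (bdist Ω (a j))) :=
      ((Metric.continuous_infDist_pt (frontier Ω)).tendsto _).comp (hcoord j)
    exact hδ.eventually_lt hb (bdist_pos hΩ hne (haF.1 j))
  obtain ⟨n, hn1, hn2⟩ := (h1.and h2).exists
  rcases (hu n).2 with ⟨i, j, hij, h⟩ | ⟨j, h⟩
  · exact (hn1 i j hij).not_ge h
  · exact (hn2 j).not_ge h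

theorem IsBoundedC3Domain.frontier_nonempty (hΩ : IsBoundedC3Domain Ω) :
    (frontier Ω).Nonempty := by
  refine nonempty_frontier_iff.2 ⟨hΩ.isConnected.nonempty, ?_⟩
  rintro rfl
  exact NormedSpace.unbounded_univ ℝ ℂ hΩ.isBounded

end Compactness

end PointVortex

theorem proposition4p1 {Ω : Set ℂ} (hΩ : PointVortex.IsBoundedC3Domain Ω)
    {G g : ℂ → ℂ → ℝ} (hG : PointVortex.IsGreenFunction Ω G g)
    {N : ℕ} (Γ : Fin N → ℝ) (hΓ : ∀ i, Γ i ≠ 0)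
    (hbdry : PointVortex.BdryAdmissible Ω Γ) (hdiag : PointVortex.DiagAdmissible Γ) :
    (∃ δ : ℝ, 0 < δ ∧ ∀ z ∈ PointVortex.nearSingular Ω N δ,
      1 < ‖gradient (PointVortex.kirchhoffRouth G g Γ) z‖) ∧
    PointVortex.PalaisSmale (PointVortex.configSpace Ω N) (PointVortex.kirchhoffRouth G g Γ) ∧
    (∀ (z : ℝ → PointVortex.Conf N) (T : EReal),
      PointVortex.IsMaximalFlowLine (PointVortex.configSpace Ω N)
        (PointVortex.kirchhoffRouth G g Γ) z T →
      (∃ c : ℝ, Tendsto (fun t => PointVortex.kirchhoffRouth G g Γ (z t))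
        (PointVortex.toEnd T) (𝓝 c)) →
      T = ⊤ ∧ ∃ (s : ℕ → ℝ) (zs : PointVortex.Conf N),
        (∀ n, 0 ≤ s n) ∧ Tendsto s atTop atTop ∧ zs ∈ PointVortex.configSpace Ω N ∧
        Tendsto (fun n => z (s n)) atTop (𝓝 zs) ∧
        HasGradientAt (PointVortex.kirchhoffRouth G g Γ) 0 zs) := by
  open PointVortex in
  set F := configSpace Ω N with hF
  set H := kirchhoffRouth G g Γ with hH
  have hblow : ∀ a : Conf N, (∀ i, a i ∈ closure Ω) → a ∉ F →
      ∃ c : ℝ, 0 < c ∧ ∀ᶠ x in 𝓝[F] a, c ≤ ‖gradient H x‖ * ‖x - a‖ := fun a h1 h2 =>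
    exists_le_norm_gradient_mul hΩ.isOpen hΩ.boundary hG hΓ hdiag h1 h2
  have hgrad : ∀ x ∈ F, HasGradientAt H (gradient H x) x := fun x hx =>
    hasGradientAt_kirchhoffRouth hG hΩ.isOpen Γ hx
  have hFo : IsOpen F := isOpen_configSpace hΩ.isOpen N
  have hgc : ∀ x ∈ F, ContinuousAt (gradient H) x := fun x hx =>
    continuousAt_gradient_kirchhoffRouth hG hΩ.isOpen Γ hx
  -- a sequence with bounded gradients cannot approach a singular configuration
  have hlimF : ∀ (u : ℕ → Conf N) (a : Conf N), (∀ n, u n ∈ F) → Tendsto u atTop (𝓝 a) →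
      (∀ i, a i ∈ closure Ω) → (∀ᶠ n in atTop, ‖gradient H (u n)‖ ≤ 1) → a ∈ F := by
    intro u a hu ha hcl hb
    by_contra haF
    obtain ⟨c, hc, hev⟩ := hblow a hcl haF
    have haw : Tendsto u atTop (𝓝[F] a) :=
      tendsto_nhdsWithin_iff.2 ⟨ha, Eventually.of_forall hu⟩
    have h0 : Tendsto (fun n => ‖u n - a‖) atTop (𝓝 0) := tendsto_iff_norm_sub_tendsto_zero.1 ha
    obtain ⟨n, ⟨h1, h2⟩, h3⟩ :=
      (((haw.eventually hev).and hb).and (h0.eventually (gt_mem_nhds hc))).exists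
    have := norm_nonneg (u n - a)
    nlinarith
  have hPS : PalaisSmale F H := by
    intro u hu _ hlim
    obtain ⟨a, hcl, k, hk, ha⟩ := exists_subseq_tendsto hΩ.isBounded u hu
    refine ⟨a, hlimF _ a (fun n => hu (k n)) ha hcl ?_, k, hk, ha⟩
    have h1 := (hlim.comp hk.tendsto_atTop).norm
    rw [norm_zero] at h1
    exact h1.eventually (ge_mem_nhds one_pos)
  refine ⟨?_, hPS, ?_⟩
  · by_contra! hcon
    have hpos : ∀ n : ℕ, 0 < 1 / ((n : ℝ) + 1) := fun n => by positivity
    choose u hu hu1 using fun n : ℕ => hcon (1 / ((n : ℝ) + 1)) (hpos n)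
    obtain ⟨a, hcl, k, hk, ha⟩ := exists_subseq_tendsto hΩ.isBounded u fun n => (hu n).1
    refine notMem_configSpace_of_nearSingular hΩ.isOpen hΩ.frontier_nonempty
      (tendsto_one_div_add_atTop_nhds_zero_nat.comp hk.tendsto_atTop) (fun n => hu (k n)) ha ?_
    exact hlimF _ a (fun n => (hu (k n)).1) ha hcl (Eventually.of_forall fun n => hu1 (k n))
  · rintro z T hz ⟨c, hc⟩
    have hT : T = ⊤ := by
      induction T with
      | bot => exact absurd hz.1.1 not_lt_bot
      | top => rfl
      | coe r =>
        exfalso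
        replace hc := hc.mono_left (nhdsLT_le_toEnd r)
        obtain ⟨a, ha⟩ := hz.1.exists_tendsto hgrad hc
        refine hz.limit_notMem hFo (fun x hx => (hgc x hx).continuousWithinAt) ha
          (hz.1.limit_mem hgrad hc ha (hblow a fun i => ?_))
        have hr : 0 < r := EReal.coe_pos.1 hz.1.1
        refine mem_closure_of_tendsto ((tendsto_coord le_rfl i).comp ha) ?_
        filter_upwards [Ioo_mem_nhdsLT hr] with t ht
        exact (hz.1.2 t ht.1.le (EReal.coe_lt_coe_iff.2 ht.2)).1.1 i
    subst hT
    refine ⟨rfl, ?_⟩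
    replace hc := hc.mono_left atTop_le_toEnd
    have hle : ∀ t, 0 ≤ t → H (z t) ≤ c := fun t ht =>
      ge_of_tendsto hc ((eventually_ge_atTop t).mono fun s hs =>
        hz.1.le_of_le hgrad ht hs (EReal.coe_lt_top s))
    choose s hs1 hs2 using fun n : ℕ => hz.1.exists_norm_gradient_lt hgrad hle
      (show 0 < 1 / ((n : ℝ) + 1) by positivity) (Nat.cast_nonneg (α := ℝ) n)
    have hs0 : ∀ n, 0 ≤ s n := fun n => (Nat.cast_nonneg n).trans (hs1 n)
    have hsF : ∀ n, z (s n) ∈ F := fun n => (hz.1.2 _ (hs0 n) (EReal.coe_lt_top _)).1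
    have hsg : Tendsto (fun n => gradient H (z (s n))) atTop (𝓝 0) :=
      squeeze_zero_norm (fun n => (hs2 n).le) tendsto_one_div_add_atTop_nhds_zero_nat
    have hbd : ∀ n, |H (z (s n))| ≤ max |H (z 0)| |c| := fun n =>
      abs_le_max_abs_abs (hz.1.le_of_le hgrad le_rfl (hs0 n) (EReal.coe_lt_top _)) (hle _ (hs0 n))
    obtain ⟨zs, hzs, k, hk, hlim⟩ := hPS (fun n => z (s n)) hsF ⟨_, hbd⟩ hsg
    have hs_lim : Tendsto s atTop atTop := tendsto_atTop_mono hs1 tendsto_natCast_atTop_atTop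
    refine ⟨fun n => s (k n), zs, fun n => hs0 _, hs_lim.comp hk.tendsto_atTop, hzs, hlim, ?_⟩
    have h0 : gradient H zs = 0 := tendsto_nhds_unique ((hgc zs hzs).tendsto.comp hlim)
      (hsg.comp hk.tendsto_atTop)
    rw [← h0]
    exact hgrad zs hzs
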